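/- For a real number $\xi$ and a positive integer $n$, let $\widehat\lambda_n(\xi)$ be the supremum of all real $\lambda$ such that for all large enough real $Q$ there is $(x_0,\dots,x_n)\in\mathbb Z^{n+1}$ with $1\le |x_0|\le Q$ and $\max_{1\le i\le n}|x_0\xi^i-x_i|<Q^{-\lambda}$. Let $\omega_n(\xi)$ be the supremum, possibly $+\infty$, of all real $\omega$ such that for arbitrarily large real $Q$ there is $P\in\mathbb Z[x]$ with $\deg P\le n$, $H(P)\le Q$ and $0<|P(\xi)|\le Q^{-\omega}$, where $H(P)$ is the maximum of the absolute values of the coefficients of $P$. Theorem. Let $\xi$ be a transcendental real number. Then $\widehat\lambda_3=\widehat\lambda_3(\xi)$ is finite and, with $\omega_1=\omega_1(\xi)$, $$2\widehat\lambda_3^{\,3}\,\omega_1-\widehat\lambda_3^{\,2}(\omega_1-1)+2\widehat\lambda_3\le 1,$$ where for $\omega_1=+\infty$ the inequality is understood in the limit, that is, it means that the coefficient $2\widehat\lambda_3^{\,3}-\widehat\lambda_3^{\,2}$ of $\omega_1$ is negative. In particular, if $\omega_1(\xi)=1$, then $\widehat\lambda_3(\xi)\le\lambda_3$, where $\lambda_3=0.42385\ldots$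 is the real root of $2x^3+2x=1$ (this improves Roy's bound $0.4245\ldots$). -/

import Mathlib

open Filter Polynomial

/-- `UniformSimApprox n ξ l`: for every large enough real `Q` the system
`max_{1 ≤ i ≤ n} |x₀ ξ^i - x_i| < Q^(-l)`, `1 ≤ |x₀| ≤ Q` has a solution
`x = (x₀, …, x_n)` in integers. -/
def UniformSimApprox (n : ℕ) (ξ l : ℝ) : Prop :=
  ∀ᶠ Q : ℝ in atTop, ∃ x : Fin (n + 1) → ℤ,
    1 ≤ |x 0| ∧ (|x 0| : ℝ) ≤ Q ∧
      ∀ i : Fin n, |(x 0 : ℝ) * ξ ^ ((i : ℕ) + 1) - (x i.succ : ℝ)| < Q ^ (-l)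

/-- The uniform simultaneous Diophantine exponent `λ̂_n(ξ)`, a supremum taken in the
extended reals. -/
noncomputable def lambdaHat (n : ℕ) (ξ : ℝ) : EReal :=
  sSup ((fun l : ℝ => (l : EReal)) '' {l : ℝ | UniformSimApprox n ξ l})

/-- `DualApprox n ξ w`: for arbitrarily large real `Q` the system
`0 < |P(ξ)| ≤ Q^(-w)`, `deg P ≤ n`, `H(P) ≤ Q` has a solution `P ∈ ℤ[X]`, where `H(P)` is the
maximum of the absolute values of the coefficients of `P`. -/
def DualApprox (n : ℕ) (ξ w : ℝ) : Prop :=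
  ∃ᶠ Q : ℝ in atTop, ∃ P : ℤ[X],
    P.natDegree ≤ n ∧ (∀ k : ℕ, (|P.coeff k| : ℝ) ≤ Q) ∧
      0 < |aeval ξ P| ∧ |aeval ξ P| ≤ Q ^ (-w)

/-- The dual Diophantine exponent `ω_n(ξ)`, a supremum taken in the extended reals
(it is `⊤` for `n = 1` and `ξ` a Liouville number). -/
noncomputable def omegaExp (n : ℕ) (ξ : ℝ) : EReal :=
  sSup ((fun w : ℝ => (w : EReal)) '' {w : ℝ | DualApprox n ξ w})

/-!
Write `λ` for an exponent of uniform approximation to `(ξ, ξ², ξ³)`. Only `λ² + 2λ > 1` matters,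
since otherwise the inequality follows from `λ ≤ 1/2` and `ω₁ ≥ 0`.

Let `x₀, x₁, …` be the minimal points in `ℤ⁴`, with first coordinates `X_i` and errors `L_i`, so
that `L_i ≪ X_{i+1}^(-λ)`. For a point `x` put `x⁻ = (x₀, x₁, x₂)` and `x⁺ = (x₁, x₂, x₃)`; the
cross product `x⁻ × x⁺` (`hankelCross`) has size `≪ X L` and pairs with `(1, ξ, ξ²)` to `≪ L²`.
Therefore the integers `C⁻ = (x⁻ × x⁺) · y⁻` and `C⁺ = (x⁻ × x⁺) · y⁺` attached to two points `x, y`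
(`lowerPair` and `upperPair`) satisfy `|C^±| ≪ Y L_x² + X L_x L_y` and
`|ξ C⁻ - C⁺| ≪ X L_x L_y`. If they do not both vanish, they give a rational approximation to `ξ`,
which is where `ω₁` enters.

For `λ² + 2λ > 1` this pair does not vanish at the start of a maximal run of minimal points in one
plane (`IsMinimalSeq.pair_ne_zero`): otherwise a primitive vector `r` and its shift cut out the
plane, the height of the plane, about `X_{i+1} L_i`, is that of `r` squared, and this contradicts
the bounds for `r` at `x_{i-1}` and `x_i`. The argument uses that consecutive minimal points
generate the integer points of their plane (`IsMinimalSeq.dvd_of_smul_eq_comb`).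

As `1, ξ, ξ², ξ³` are independent, there are arbitrarily late runs `x_i, …, x_j` in a plane such
that `x_{i-1}, x_{j-1}, x_j, x_{j+1}` are independent (`IsMinimalSeq.exists_run`). For such a run,
* the determinant of these four points gives `1 ≪ X_{j+1} L_{i-1} L_{j-1} L_j`;
* the pair of `x_j, x_{j-1}` gives `1 ≪ X_j L_j L_{j-1}`;
* the pair of `x_i, x_{i+1}` has height `≪ X_{i+1} L_i² ≪ X_j^(1-2λ)` and value at `ξ`
  `≪ X_i L_{j-1} L_j`.

Eliminating everything but `X_j`, the value is `≪ X_j^(-(λ²+2λ-1)/λ²)`; comparison with the height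
yields `λ² + 2λ - 1 ≤ λ² (1 - 2λ) w` for every `w > ω₁` (`exponent_inequality`). When `λ > 1/3`,
the exponent `ω₁` is at most `4` (`not_dualApprox_of_uniformSimApprox`), so that `ω₁ = ⊤` forces
`λ ≤ 1/3`, and the general case follows by passing to the limit in `λ` and `w`.
-/

/-! ### Integer points, their errors, and minimal points -/

/-- The error vector of an integer point `x` as an approximation to `x₀ (1, ξ, ξ², ξ³)`; its
coordinate of index `0` vanishes. -/
def err (ξ : ℝ) (x : Fin 4 → ℤ) : Fin 4 → ℝ := fun k => (x 0 : ℝ) * ξ ^ (k : ℕ) - (x k : ℝ)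

lemma err_zero_coord (ξ : ℝ) (x : Fin 4 → ℤ) : err ξ x 0 = 0 := by simp [err]

lemma abs_err_le (ξ : ℝ) (x : Fin 4 → ℤ) (k : Fin 4) : |err ξ x k| ≤ ‖err ξ x‖ := by
  simpa using norm_le_pi_norm (err ξ x) k

lemma err_comb (ξ : ℝ) (a b : ℤ) (x y : Fin 4 → ℤ) :
    err ξ (a • x + b • y) = (a : ℝ) • err ξ x + (b : ℝ) • err ξ y := by
  ext k; simp [err]; ring

lemma one_le_norm_err_of_zero {ξ : ℝ} {z : Fin 4 → ℤ} (hz : z ≠ 0) (h0 : z 0 = 0) :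
    1 ≤ ‖err ξ z‖ := by
  obtain ⟨k, hk⟩ := Function.ne_iff.mp hz
  have h := abs_err_le ξ z k
  have h1 : (1 : ℝ) ≤ |(z k : ℝ)| := by exact_mod_cast Int.one_le_abs hk
  simp only [err, h0, Int.cast_zero, zero_mul, zero_sub, abs_neg] at h
  exact h1.trans h

/-- The integer point with first coordinate `q` nearest to `q (1, ξ, ξ², ξ³)`. -/
noncomputable def nearestPoint (ξ : ℝ) (q : ℕ) : Fin 4 → ℤ := fun k => round ((q : ℝ) * ξ ^ (k : ℕ))

lemma nearestPoint_zero (ξ : ℝ) (q : ℕ) : nearestPoint ξ q 0 = q := by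
  simp [nearestPoint]

/-- The nearest point has the least error among all points with the same `|x₀|`. -/
lemma norm_err_nearestPoint_le (ξ : ℝ) (z : Fin 4 → ℤ) :
    ‖err ξ (nearestPoint ξ (z 0).natAbs)‖ ≤ ‖err ξ z‖ := by
  refine (pi_norm_le_iff_of_nonneg (norm_nonneg _)).2 fun k => ?_
  refine le_trans ?_ (abs_err_le ξ z k)
  have h1 : ((nearestPoint ξ (z 0).natAbs 0 : ℤ) : ℝ) = |(z 0 : ℝ)| := by
    rw [nearestPoint_zero]; simp
  have h2 : (((z 0).natAbs : ℕ) : ℝ) = |(z 0 : ℝ)| := by simp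
  simp only [err, Real.norm_eq_abs, h1]
  simp only [nearestPoint, h2]
  rcases le_total 0 (z 0 : ℝ) with h | h
  · rw [abs_of_nonneg h]
    exact round_le _ _
  · rw [abs_of_nonpos h]
    refine (round_le _ (-z k)).trans (le_of_eq ?_)
    rw [← abs_neg]
    push_cast
    ring_nf

lemma norm_err_nearestPoint_le_half (ξ : ℝ) (q : ℕ) : ‖err ξ (nearestPoint ξ q)‖ ≤ 1 / 2 := by
  refine (pi_norm_le_iff_of_nonneg (by norm_num)).2 fun k => ?_
  simp only [err, nearestPoint_zero, Real.norm_eq_abs]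
  exact abs_sub_round _

lemma norm_err_pos {ξ : ℝ} (hξ : Irrational ξ) {z : Fin 4 → ℤ} (hz : z ≠ 0) : 0 < ‖err ξ z‖ := by
  by_cases h0 : z 0 = 0
  · exact one_pos.trans_le (one_le_norm_err_of_zero hz h0)
  · refine lt_of_lt_of_le ?_ (abs_err_le ξ z 1)
    rw [abs_pos]
    simp only [err, Fin.val_one, pow_one]
    exact sub_ne_zero.2 ((hξ.intCast_mul h0).ne_int _)

/-- A sequence of minimal points: first coordinates increase, errors decrease, and no nonzero
integer point with first coordinate below that of the next term has a smaller error. -/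
structure IsMinimalSeq (ξ : ℝ) (x : ℕ → Fin 4 → ℤ) : Prop where
  pos : ∀ i, 0 < x i 0
  mono : StrictMono fun i => x i 0
  anti : StrictAnti fun i => ‖err ξ (x i)‖
  err_pos : ∀ i, 0 < ‖err ξ (x i)‖
  err_le_one : ∀ i, ‖err ξ (x i)‖ ≤ 1
  minimal : ∀ i z, z ≠ 0 → |z 0| < x (i + 1) 0 → ‖err ξ (x i)‖ ≤ ‖err ξ z‖

lemma uniformSimApprox_iff (ξ l : ℝ) :
    UniformSimApprox 3 ξ l ↔ ∀ᶠ Q : ℝ in atTop, ∃ x : Fin 4 → ℤ,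
      x 0 ≠ 0 ∧ |(x 0 : ℝ)| ≤ Q ∧ ‖err ξ x‖ < Q ^ (-l) := by
  unfold UniformSimApprox
  constructor
  · intro h
    filter_upwards [h, eventually_gt_atTop 0] with Q ⟨x, h1, h2, h3⟩ hQ
    refine ⟨x, by rintro h; simp [h] at h1, by exact_mod_cast h2, ?_⟩
    refine (pi_norm_lt_iff (Real.rpow_pos_of_pos hQ _)).2 fun k => ?_
    refine Fin.cases ?_ (fun i => ?_) k
    · rw [err_zero_coord, norm_zero]; exact Real.rpow_pos_of_pos hQ _
    · simpa [err] using h3 i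
  · intro h
    filter_upwards [h] with Q ⟨x, h1, h2, h3⟩
    refine ⟨x, Int.one_le_abs h1, by exact_mod_cast h2, fun i => ?_⟩
    refine lt_of_le_of_lt ?_ h3
    simpa [err] using abs_err_le ξ x i.succ

lemma UniformSimApprox.mono {ξ l l' : ℝ} (h : UniformSimApprox 3 ξ l) (hl : l' ≤ l) :
    UniformSimApprox 3 ξ l' := by
  unfold UniformSimApprox at *
  filter_upwards [h, eventually_ge_atTop 1] with Q ⟨x, h1, h2, h3⟩ hQ
  exact ⟨x, h1, h2, fun i => (h3 i).trans_le
    (Real.rpow_le_rpow_of_exponent_le hQ (neg_le_neg hl))⟩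

/-- Minimal points exist, and uniform approximability with exponent `l` bounds the error of each
by the size of the next. -/
theorem exists_isMinimalSeq {ξ l : ℝ} (hξ : Irrational ξ) (hl : 0 < l)
    (h : UniformSimApprox 3 ξ l) :
    ∃ x, IsMinimalSeq ξ x ∧
      ∃ K, ∀ i, Real.log ‖err ξ (x i)‖ ≤ K - l * Real.log (x (i + 1) 0) := by
  classical
  rw [uniformSimApprox_iff] at h
  set f : ℕ → ℝ := fun q => ‖err ξ (nearestPoint ξ q)‖ with hf
  have fpos : ∀ q, 0 < q → 0 < f q := fun q hq => norm_err_pos hξ fun h0 => by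
    have := congrFun h0 0
    rw [nearestPoint_zero] at this
    simp at this; omega
  have hle : ∀ z : Fin 4 → ℤ, f (z 0).natAbs ≤ ‖err ξ z‖ := norm_err_nearestPoint_le ξ
  have hex : ∀ q : ℕ, 0 < q → ∃ p : ℕ, 0 < p ∧ f p < f q := by
    intro q hq
    have ht : Tendsto (fun Q : ℝ => Q ^ (-l)) atTop (nhds 0) := tendsto_rpow_neg_atTop hl
    obtain ⟨Q, ⟨x, hx0, -, hx⟩, hQ⟩ := (h.and (ht.eventually_lt_const (fpos q hq))).exists
    exact ⟨(x 0).natAbs, Int.natAbs_pos.2 hx0, ((hle x).trans_lt hx).trans hQ⟩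
  -- the next minimal point is the first one with a smaller error
  let next : {q : ℕ // 0 < q} → {q : ℕ // 0 < q} := fun q =>
    ⟨Nat.find (hex q q.2), (Nat.find_spec (hex q q.2)).1⟩
  let s : ℕ → {q : ℕ // 0 < q} := fun n => next^[n] ⟨1, one_pos⟩
  have hs : ∀ n, s (n + 1) = next (s n) := fun n => Function.iterate_succ_apply' _ _ _
  have hdec : ∀ n, f (s (n + 1)) < f (s n) := fun n => by
    rw [hs]; exact (Nat.find_spec (hex (s n) (s n).2)).2
  have hmin : ∀ n (p : ℕ), 0 < p → p < s (n + 1) → f (s n) ≤ f p := fun n p hp hlt => by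
    rw [hs] at hlt
    have := Nat.find_min (hex (s n) (s n).2) hlt
    push Not at this
    exact this hp
  have hinc : ∀ n, (s n : ℕ) < s (n + 1) := by
    intro n
    by_contra hcon
    push Not at hcon
    have hne : (s (n + 1) : ℕ) ≠ s n := fun he => by
      have := hdec n; rw [he] at this; exact lt_irrefl _ this
    have hlt : (s (n + 1) : ℕ) < s n := lt_of_le_of_ne hcon hne
    cases n with
    | zero => have := (s (0 + 1)).2; have h1 : (s 0 : ℕ) = 1 := rfl; omega
    | succ m =>
      have := hmin m _ (s (m + 1 + 1)).2 hlt
      exact absurd ((hdec (m + 1)).trans (hdec m)) (not_lt.2 this)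
  have hx0 : ∀ i, nearestPoint ξ (s i) 0 = (s i : ℕ) := fun i => nearestPoint_zero ξ _
  refine ⟨fun i => nearestPoint ξ (s i), ⟨?_, ?_, ?_, ?_, ?_, ?_⟩, ?_⟩
  · intro i; rw [hx0]; exact_mod_cast (s i).2
  · refine strictMono_nat_of_lt_succ fun n => ?_
    simp only [hx0]; exact_mod_cast hinc n
  · exact strictAnti_nat_of_succ_lt hdec
  · exact fun i => fpos _ (s i).2
  · exact fun i => (norm_err_nearestPoint_le_half ξ _).trans (by norm_num)
  · intro i z hz hlt
    by_cases h0 : z 0 = 0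
    · exact ((norm_err_nearestPoint_le_half ξ _).trans (by norm_num)).trans
        (one_le_norm_err_of_zero hz h0)
    · refine (hmin i _ (Int.natAbs_pos.2 h0) ?_).trans (hle z)
      simp only [hx0, Int.abs_eq_natAbs] at hlt
      exact_mod_cast hlt
  · obtain ⟨Q₀, hQ₀⟩ := eventually_atTop.1 h
    have hQ1 : 0 ≤ Real.log (max Q₀ 1 + 1) := Real.log_nonneg (by
      have := le_max_right Q₀ 1; linarith)
    have h2 : 0 ≤ Real.log 2 := Real.log_nonneg (by norm_num)
    refine ⟨l * Real.log (max Q₀ 1 + 1) + l * Real.log 2, fun i => ?_⟩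
    have hpos : 0 < f (s i) := fpos _ (s i).2
    have hX : (2 : ℝ) ≤ (s (i + 1) : ℕ) := by
      have := (s i).2; have := hinc i; exact_mod_cast (by omega : 2 ≤ (s (i + 1) : ℕ))
    simp only [hx0, Int.cast_natCast]
    rcases le_total ((s (i + 1) : ℕ) : ℝ) (max Q₀ 1 + 1) with hc | hc
    · have h1 : Real.log (f (s i)) ≤ 0 := Real.log_nonpos hpos.le
        ((norm_err_nearestPoint_le_half ξ _).trans (by norm_num))
      have h3 : Real.log ((s (i + 1) : ℕ) : ℝ) ≤ Real.log (max Q₀ 1 + 1) :=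
        Real.log_le_log (by linarith) hc
      have := mul_le_mul_of_nonneg_left h3 hl.le
      have := mul_nonneg hl.le h2
      change Real.log (f (s i)) ≤ _
      linarith
    · obtain ⟨z, hz0, hz1, hz2⟩ := hQ₀ (((s (i + 1) : ℕ) : ℝ) - 1)
        (by have := le_max_left Q₀ 1; linarith)
      have h1 : f (s i) ≤ ‖err ξ z‖ := by
        refine (hmin i _ (Int.natAbs_pos.2 hz0) ?_).trans (hle z)
        have : (((z 0).natAbs : ℕ) : ℝ) < ((s (i + 1) : ℕ) : ℝ) := by
          rw [Nat.cast_natAbs, Int.cast_abs]; linarith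
        exact_mod_cast this
      have h3 : Real.log (f (s i)) ≤ -l * Real.log (((s (i + 1) : ℕ) : ℝ) - 1) := by
        rw [← Real.log_rpow (by linarith)]
        exact Real.log_le_log hpos (h1.trans hz2.le)
      have h4 : Real.log ((s (i + 1) : ℕ) : ℝ) ≤
          Real.log 2 + Real.log (((s (i + 1) : ℕ) : ℝ) - 1) := by
        rw [← Real.log_mul (by norm_num) (by linarith)]
        exact Real.log_le_log (by linarith) (by linarith)
      have := mul_le_mul_of_nonneg_left h4 hl.le
      have := mul_nonneg hl.le hQ1
      change Real.log (f (s i)) ≤ _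
      linarith

/-! ### Planes of integer points and Plücker coordinates -/

/-- The Plücker coordinates of the plane spanned by `x` and `y`, in the order
`01, 02, 03, 12, 13, 23`. -/
def wedge (x y : Fin 4 → ℤ) : Fin 6 → ℤ :=
  ![x 0 * y 1 - x 1 * y 0, x 0 * y 2 - x 2 * y 0, x 0 * y 3 - x 3 * y 0,
    x 1 * y 2 - x 2 * y 1, x 1 * y 3 - x 3 * y 1, x 2 * y 3 - x 3 * y 2]

/-- The Plücker coordinates of the plane of all `x` with `lowerPair r x = upperPair r x = 0`. -/
def dualWedge (r : Fin 3 → ℤ) : Fin 6 → ℤ :=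
  ![r 2 * r 2, -(r 1 * r 2), r 1 * r 1 - r 0 * r 2, r 0 * r 2, -(r 0 * r 1), r 0 * r 0]

/-- The pairing of `r` with `(x₀, x₁, x₂)`. -/
def lowerPair (r : Fin 3 → ℤ) (x : Fin 4 → ℤ) : ℤ := r 0 * x 0 + r 1 * x 1 + r 2 * x 2

/-- The pairing of `r` with `(x₁, x₂, x₃)`. -/
def upperPair (r : Fin 3 → ℤ) (x : Fin 4 → ℤ) : ℤ := r 0 * x 1 + r 1 * x 2 + r 2 * x 3

/-- The cross product of `(x₀, x₁, x₂)` and `(x₁, x₂, x₃)`. -/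
def hankelCross (x : Fin 4 → ℤ) : Fin 3 → ℤ :=
  ![x 1 * x 3 - x 2 * x 2, x 1 * x 2 - x 0 * x 3, x 0 * x 2 - x 1 * x 1]

lemma lowerPair_hankelCross_self (x : Fin 4 → ℤ) : lowerPair (hankelCross x) x = 0 := by
  simp [lowerPair, hankelCross]; ring

lemma upperPair_hankelCross_self (x : Fin 4 → ℤ) : upperPair (hankelCross x) x = 0 := by
  simp [upperPair, hankelCross]; ring

lemma lowerPair_comb (r : Fin 3 → ℤ) (a b : ℤ) (x y : Fin 4 → ℤ) :
    lowerPair r (a • x + b • y) = a * lowerPair r x + b * lowerPair r y := by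
  simp [lowerPair]; ring

lemma upperPair_comb (r : Fin 3 → ℤ) (a b : ℤ) (x y : Fin 4 → ℤ) :
    upperPair r (a • x + b • y) = a * upperPair r x + b * upperPair r y := by
  simp [upperPair]; ring

lemma wedge_comb (a b c d : ℤ) (x y : Fin 4 → ℤ) (k : Fin 6) :
    wedge (a • x + b • y) (c • x + d • y) k = (a * d - b * c) * wedge x y k := by
  fin_cases k <;> simp [wedge] <;> ring

/-- Two points annihilated by `r` and its shift have Plücker coordinates proportional to those
of the plane cut out by `r`. -/
lemma wedge_mul_dualWedge {r : Fin 3 → ℤ} {x y : Fin 4 → ℤ} (h1 : lowerPair r x = 0)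
    (h2 : upperPair r x = 0) (h3 : lowerPair r y = 0) (h4 : upperPair r y = 0) (k l : Fin 6) :
    wedge x y k * dualWedge r l = wedge x y l * dualWedge r k := by
  simp only [lowerPair, upperPair] at h1 h2 h3 h4
  set p01 := x 0 * y 1 - x 1 * y 0 with d01
  set p02 := x 0 * y 2 - x 2 * y 0 with d02
  set p03 := x 0 * y 3 - x 3 * y 0 with d03
  set p12 := x 1 * y 2 - x 2 * y 1 with d12
  set p13 := x 1 * y 3 - x 3 * y 1 with d13
  set p23 := x 2 * y 3 - x 3 * y 2 with d23
  have e1 : r 0 * p01 = r 2 * p12 := by rw [d01, d12]; linear_combination y 1 * h1 - x 1 * h3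
  have e2 : r 0 * p02 = -(r 1 * p12) := by rw [d02, d12]; linear_combination y 2 * h1 - x 2 * h3
  have e3 : r 1 * p01 = -(r 2 * p02) := by rw [d01, d02]; linear_combination x 0 * h3 - y 0 * h1
  have e4 : r 0 * p12 = r 2 * p23 := by rw [d12, d23]; linear_combination y 2 * h2 - x 2 * h4
  have e5 : r 0 * p13 = -(r 1 * p23) := by rw [d13, d23]; linear_combination y 3 * h2 - x 3 * h4
  have e6 : r 1 * p12 = -(r 2 * p13) := by rw [d12, d13]; linear_combination x 1 * h4 - y 1 * h2
  have e7 : r 0 * p03 = -(r 1 * p13) - r 2 * p23 := by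
    rw [d03, d13, d23]; linear_combination y 3 * h1 - x 3 * h3
  have e8 : r 2 * p03 = -(r 0 * p01) - r 1 * p02 := by
    rw [d03, d01, d02]; linear_combination x 0 * h4 - y 0 * h2
  clear_value p01 p02 p03 p12 p13 p23
  have hw : wedge x y = ![p01, p02, p03, p12, p13, p23] := by
    simp only [wedge, d01, d02, d03, d12, d13, d23]
  rw [hw]
  clear d01 d02 d03 d12 d13 d23 h1 h2 h3 h4 hw
  fin_cases k <;> fin_cases l <;> simp [dualWedge] <;> grind

/-- A family of integers without common divisor satisfies a Bézout identity. -/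
lemma exists_bezout {ι : Type*} [Fintype ι] {P : ι → ℤ} (hP : ∀ t, (∀ a, t ∣ P a) → IsUnit t) :
    ∃ u : ι → ℤ, ∑ a, u a * P a = 1 := by
  obtain ⟨g, hg⟩ := (IsPrincipalIdealRing.principal (Ideal.span (Set.range P))).principal
  have hu : IsUnit g := hP g fun a => by
    rw [← Ideal.mem_span_singleton, ← Ideal.submodule_span_eq, ← hg]
    exact Ideal.subset_span ⟨a, rfl⟩
  have h1 : (1 : ℤ) ∈ Ideal.span (Set.range P) := by
    rw [hg, Ideal.submodule_span_eq, Ideal.span_singleton_eq_top.2 hu]; trivial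
  obtain ⟨u, hu⟩ := (Ideal.mem_span_range_iff_exists_fun).1 h1
  exact ⟨u, hu⟩

/-- An integer vector proportional to a primitive one is an integer multiple of it. -/
lemma exists_eq_mul_of_primitive {ι : Type*} [Fintype ι] {P M : ι → ℤ}
    (hP : ∀ t, (∀ a, t ∣ P a) → IsUnit t) (h : ∀ a b, M a * P b = M b * P a) :
    ∃ c, ∀ a, M a = c * P a := by
  obtain ⟨u, hu⟩ := exists_bezout hP
  refine ⟨∑ a, u a * M a, fun b => ?_⟩
  calc M b = M b * ∑ a, u a * P a := by rw [hu, mul_one]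
    _ = (∑ a, u a * M a) * P b := by
      rw [Finset.mul_sum, Finset.sum_mul]
      exact Finset.sum_congr rfl fun a _ => by linear_combination u a * h b a

lemma dualWedge_primitive {r : Fin 3 → ℤ} (hr : ∀ t, (∀ a, t ∣ r a) → IsUnit t) (t : ℤ)
    (ht : ∀ a, t ∣ dualWedge r a) : IsUnit t := by
  obtain ⟨u, hu⟩ := exists_bezout hr
  have h0 := ht 0
  have h1 := ht 1
  have h2 := ht 2
  have h3 := ht 3
  have h4 := ht 4
  have h5 := ht 5
  simp only [dualWedge, Matrix.cons_val, dvd_neg] at h0 h1 h2 h3 h4 h5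
  have h6 : t ∣ r 1 * r 1 := by simpa using dvd_add h2 h3
  rw [Fin.sum_univ_three] at hu
  have : (1 : ℤ) = u 2 * u 2 * (r 2 * r 2) + 2 * u 1 * u 2 * (r 1 * r 2) + u 1 * u 1 * (r 1 * r 1)
      + 2 * u 0 * u 2 * (r 0 * r 2) + 2 * u 0 * u 1 * (r 0 * r 1) + u 0 * u 0 * (r 0 * r 0) := by
    linear_combination (-(u 0 * r 0 + u 1 * r 1 + u 2 * r 2) - 1) * hu
  refine isUnit_of_dvd_one (this ▸ ?_)
  exact dvd_add (dvd_add (dvd_add (dvd_add (dvd_add (h0.mul_left _) (h1.mul_left _))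
    (h6.mul_left _)) (h3.mul_left _)) (h4.mul_left _)) (h5.mul_left _)

/-- Every nonzero integer vector is an integer multiple of a primitive one. -/
lemma exists_primitive {ι : Type*} [Fintype ι] {v : ι → ℤ} (hv : v ≠ 0) :
    ∃ (m : ℤ) (r : ι → ℤ), m ≠ 0 ∧ (∀ a, v a = m * r a) ∧ ∀ t, (∀ a, t ∣ r a) → IsUnit t := by
  obtain ⟨a, ha⟩ := Function.ne_iff.mp hv
  obtain ⟨r, hr, hr1⟩ := Finset.extract_gcd v ⟨a, Finset.mem_univ a⟩
  have hm : Finset.univ.gcd v ≠ 0 := fun h => ha ((Finset.gcd_eq_zero_iff.1 h) a (Finset.mem_univ a))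
  refine ⟨_, r, hm, fun a => hr a (Finset.mem_univ a), fun t ht => ?_⟩
  exact isUnit_of_dvd_one (hr1 ▸ Finset.dvd_gcd fun a _ => ht a)

namespace IsMinimalSeq

variable {ξ : ℝ} {x : ℕ → Fin 4 → ℤ}

lemma pos_real (hx : IsMinimalSeq ξ x) (i : ℕ) : (0 : ℝ) < x i 0 := by exact_mod_cast hx.pos i

lemma one_le (hx : IsMinimalSeq ξ x) (i : ℕ) : (1 : ℝ) ≤ x i 0 := by exact_mod_cast hx.pos i

lemma lt_real (hx : IsMinimalSeq ξ x) {i j : ℕ} (h : i < j) : (x i 0 : ℝ) < x j 0 := by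
  exact_mod_cast hx.mono h

/-- Two minimal points are far from proportional: some coordinate of their wedge is of the
largest possible order. -/
lemma exists_wedge_ge (hx : IsMinimalSeq ξ x) {i j : ℕ} (hij : i < j) :
    ∃ k : Fin 6, k ≤ 2 ∧ (x j 0 : ℝ) * ‖err ξ (x i)‖ / 3 ≤ |(wedge (x i) (x j) k : ℝ)| := by
  have key : ∃ k : Fin 4, 1 ≤ k ∧ (x j 0 : ℝ) * ‖err ξ (x i)‖ / 3 ≤
      |(x i 0 : ℝ) * x j k - x i k * x j 0| := by
    have hm : ∀ k, (x i 0 : ℝ) * x j k - x i k * x j 0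
        = x j 0 * err ξ (x i) k - x i 0 * err ξ (x j) k := fun k => by simp [err]; ring
    have hL := hx.err_pos i
    have hX := hx.pos_real i
    have hXX := hx.lt_real hij
    have hLL : ‖err ξ (x j)‖ ≤ ‖err ξ (x i)‖ := (hx.anti hij).le
    have hmax : ∀ z : Fin 4 → ℤ, 0 < ‖err ξ z‖ →
        ∃ k : Fin 4, 1 ≤ k ∧ |err ξ z k| = ‖err ξ z‖ := by
      intro z hz
      obtain ⟨k, hk'⟩ := Finite.exists_max fun k => |err ξ z k|
      have hk : |err ξ z k| = ‖err ξ z‖ := le_antisymm (abs_err_le ξ z k)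
        ((pi_norm_le_iff_of_nonneg (abs_nonneg _)).2 hk')
      refine ⟨k, ?_, hk⟩
      rcases Fin.eq_zero_or_eq_succ k with rfl | ⟨m, rfl⟩
      · rw [err_zero_coord, abs_zero] at hk; exact absurd hk hz.ne
      · exact Fin.succ_pos m
    rcases le_total ((3 : ℝ) * x i 0) (2 * x j 0) with h | h
    · obtain ⟨k, hk1, hk⟩ := hmax _ hL
      refine ⟨k, hk1, ?_⟩
      rw [hm]
      have h1 := abs_sub_abs_le_abs_sub (x j 0 * err ξ (x i) k) (x i 0 * err ξ (x j) k)
      rw [abs_mul, abs_mul, hk, abs_of_pos hX, abs_of_pos (hX.trans hXX)] at h1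
      have h2 : (x i 0 : ℝ) * |err ξ (x j) k| ≤ x i 0 * ‖err ξ (x i)‖ := by
        gcongr; exact (abs_err_le _ _ _).trans hLL
      nlinarith
    · -- here `x j - x i` has a small first coordinate, so its error is large
      set z : Fin 4 → ℤ := (1 : ℤ) • x j + (-1 : ℤ) • x i with hz
      have hz0 : z 0 = x j 0 - x i 0 := by simp [hz]; ring
      have hzne : z ≠ 0 := fun h0 => by
        have := hx.mono hij
        have h1 := congrFun h0 0
        rw [hz0] at h1; simp at h1; simp at this; omega
      have hze : ‖err ξ (x i)‖ ≤ ‖err ξ z‖ := by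
        refine hx.minimal i z hzne ?_
        have h2 : (|z 0| : ℤ) < x i 0 := by
          rw [hz0, abs_of_pos (by have := hx.mono hij; simp at this; omega)]
          have : (x j 0 : ℝ) - x i 0 < x i 0 := by linarith
          exact_mod_cast this
        exact h2.trans (hx.mono (Nat.lt_succ_self i))
      obtain ⟨k, hk1, hk⟩ := hmax z (hL.trans_le hze)
      refine ⟨k, hk1, ?_⟩
      rw [hm]
      have h3 : err ξ z k = err ξ (x j) k - err ξ (x i) k := by
        rw [hz, err_comb]; simp; ring
      have h4 : x j 0 * err ξ (x i) k - x i 0 * err ξ (x j) k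
          = (x j 0 - x i 0 : ℝ) * err ξ (x i) k - x i 0 * err ξ z k := by rw [h3]; ring
      have h1 := abs_sub_abs_le_abs_sub (x i 0 * err ξ z k) ((x j 0 - x i 0 : ℝ) * err ξ (x i) k)
      rw [abs_mul, abs_mul, hk, abs_of_pos hX, abs_of_pos (sub_pos.2 hXX)] at h1
      have h2 : (x j 0 - x i 0 : ℝ) * |err ξ (x i) k| ≤ (x j 0 - x i 0 : ℝ) * ‖err ξ (x i)‖ := by
        have := sub_pos.2 hXX
        gcongr; exact abs_err_le _ _ _
      rw [h4, abs_sub_comm]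
      nlinarith [mul_le_mul_of_nonneg_left hze hX.le]
  obtain ⟨k, hk1, hk⟩ := key
  fin_cases k
  · simp at hk1
  · exact ⟨0, by decide, by simpa [wedge] using hk⟩
  · exact ⟨1, by decide, by simpa [wedge] using hk⟩
  · exact ⟨2, by decide, by simpa [wedge] using hk⟩

lemma wedge_ne_zero (hx : IsMinimalSeq ξ x) {i j : ℕ} (hij : i < j) :
    ∃ k, wedge (x i) (x j) k ≠ 0 := by
  obtain ⟨k, -, hk⟩ := hx.exists_wedge_ge hij
  refine ⟨k, fun h => ?_⟩
  have := mul_pos (hx.pos_real j) (hx.err_pos i)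
  rw [h] at hk
  simp at hk; linarith

lemma eq_zero_of_comb_eq_zero (hx : IsMinimalSeq ξ x) {i j : ℕ} (hij : i < j) {a b : ℤ}
    (h : a • x i + b • x j = 0) : a = 0 ∧ b = 0 := by
  obtain ⟨k, hk⟩ := hx.wedge_ne_zero hij
  have h1 := wedge_comb a b 0 1 (x i) (x j) k
  have h2 := wedge_comb 1 0 a b (x i) (x j) k
  have hw : ∀ y, wedge 0 y k = 0 ∧ wedge y 0 k = 0 := fun y => by
    fin_cases k <;> simp [wedge]
  rw [h] at h1 h2
  simp only [(hw _).1, (hw _).2] at h1 h2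
  constructor
  · simpa [hk] using h1.symm
  · simpa [hk] using h2.symm

/-- Two consecutive minimal points generate the integer points of the plane they span. -/
lemma dvd_of_smul_eq_comb (hx : IsMinimalSeq ξ x) (i : ℕ) {t a b : ℤ} {z : Fin 4 → ℤ}
    (ht : t ≠ 0) (h : t • z = a • x i + b • x (i + 1)) : t ∣ a ∧ t ∣ b := by
  have htR : (t : ℝ) ≠ 0 := by exact_mod_cast ht
  set a' : ℤ := round ((a : ℝ) / t) with ha'
  set b' : ℤ := round ((b : ℝ) / t) with hb'
  have hα : |(a : ℝ) / t - a'| ≤ 1 / 2 := abs_sub_round _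
  have hβ : |(b : ℝ) / t - b'| ≤ 1 / 2 := abs_sub_round _
  set α : ℝ := (a : ℝ) / t - a' with hαd
  set β : ℝ := (b : ℝ) / t - b' with hβd
  set z' : Fin 4 → ℤ := (1 : ℤ) • z + (-1 : ℤ) • (a' • x i + b' • x (i + 1)) with hz'
  have hz'k : ∀ k, (z' k : ℝ) = α * x i k + β * x (i + 1) k := by
    intro k
    have h1 : (t : ℝ) * z k = a * x i k + b * x (i + 1) k := by exact_mod_cast congrFun h k
    have h2 : (z' k : ℝ) = z k - (a' * x i k + b' * x (i + 1) k) := by simp [hz']; ring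
    have h3 : (z k : ℝ) = (a * x i k + b * x (i + 1) k) / t := by
      rw [← h1]; field_simp
    rw [h2, h3, hαd, hβd]; ring
  have herr : err ξ z' = α • err ξ (x i) + β • err ξ (x (i + 1)) := by
    ext k
    simp only [err, hz'k, Pi.add_apply, Pi.smul_apply, smul_eq_mul]
    ring
  by_cases h0 : z' = 0
  · have h1 : (a - t * a') • x i + (b - t * b') • x (i + 1) = 0 := by
      have h2 : z = a' • x i + b' • x (i + 1) := by
        ext k
        have := congrFun h0 k
        simp [hz'] at this ⊢
        linarith
      rw [h2] at h
      ext k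
      have := congrFun h k
      simp at this ⊢
      linear_combination -this
    obtain ⟨h2, h3⟩ := hx.eq_zero_of_comb_eq_zero (Nat.lt_succ_self i) h1
    exact ⟨⟨a', by linarith⟩, ⟨b', by linarith⟩⟩
  · exfalso
    have hX := hx.pos_real i
    have hXX := hx.lt_real (Nat.lt_succ_self i)
    have hL := hx.err_pos i
    have hLL : ‖err ξ (x (i + 1))‖ < ‖err ξ (x i)‖ := hx.anti (Nat.lt_succ_self i)
    have h1 : |z' 0| < x (i + 1) 0 := by
      have : |(z' 0 : ℝ)| < x (i + 1) 0 := by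
        rw [hz'k]
        refine (abs_add_le _ _).trans_lt ?_
        rw [abs_mul, abs_mul, abs_of_pos hX, abs_of_pos (hX.trans hXX)]
        nlinarith
      exact_mod_cast this
    have h2 := hx.minimal i z' h0 h1
    have h3 : ‖err ξ z'‖ < ‖err ξ (x i)‖ := by
      rw [herr]
      refine (norm_add_le _ _).trans_lt ?_
      rw [norm_smul, norm_smul, Real.norm_eq_abs, Real.norm_eq_abs]
      nlinarith [norm_nonneg (err ξ (x (i + 1)))]
    linarith

lemma wedge_primitive (hx : IsMinimalSeq ξ x) (i : ℕ) (t : ℤ)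
    (ht : ∀ k, t ∣ wedge (x i) (x (i + 1)) k) : IsUnit t := by
  have ht0 : t ≠ 0 := fun h0 => by
    obtain ⟨k, hk⟩ := hx.wedge_ne_zero (Nat.lt_succ_self i)
    have := ht k
    rw [h0, zero_dvd_iff] at this
    exact hk this
  set u := x i with hu
  set v := x (i + 1) with hv
  have hkl : ∀ k l, t ∣ u k * v l - u l * v k := by
    have h0 := ht 0
    have h1 := ht 1
    have h2 := ht 2
    have h3 := ht 3
    have h4 := ht 4
    have h5 := ht 5
    simp only [wedge, Matrix.cons_val] at h0 h1 h2 h3 h4 h5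
    have hs : ∀ k l, t ∣ u k * v l - u l * v k → t ∣ u l * v k - u k * v l := fun k l h => by
      rw [← dvd_neg]; simpa using h
    intro k l
    fin_cases k <;> fin_cases l <;> first | assumption | (exact hs _ _ (by assumption)) | simp
  have hdiv : ∀ k, t ∣ u k ∧ t ∣ v k := by
    intro k
    choose z hz using fun l => hkl l k
    have := hx.dvd_of_smul_eq_comb i (a := v k) (b := -u k) (z := z) ht0 (by
      ext l
      have := hz l
      simp
      linear_combination -this)
    exact ⟨by simpa using this.2, this.1⟩
  choose z hz using fun k => (hdiv k).1
  have := (hx.dvd_of_smul_eq_comb i (a := 1) (b := 0) (z := z) ht0 (by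
    ext l; have := hz l; simp; linarith)).1
  exact isUnit_of_dvd_one this

end IsMinimalSeq

/-! ### Size estimates -/

/-- Bounds `|ξ|ᵏ` for all `k ≤ 3`, hence every coordinate of an integer point up to its error. -/
noncomputable def powBound (ξ : ℝ) : ℝ := (1 + |ξ|) ^ 3

lemma one_le_powBound (ξ : ℝ) : 1 ≤ powBound ξ :=
  one_le_pow₀ (by linarith [abs_nonneg ξ])

lemma abs_pow_le_powBound (ξ : ℝ) (k : Fin 4) : |ξ ^ (k : ℕ)| ≤ powBound ξ := by
  rw [abs_pow]
  calc |ξ| ^ (k : ℕ) ≤ (1 + |ξ|) ^ (k : ℕ) := by gcongr; linarith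
    _ ≤ (1 + |ξ|) ^ 3 := pow_le_pow_right₀ (by linarith [abs_nonneg ξ]) (by omega)

lemma abs_self_le_powBound (ξ : ℝ) : |ξ| ≤ powBound ξ := by
  simpa using abs_pow_le_powBound ξ 1

lemma abs_sq_le_powBound (ξ : ℝ) : |ξ ^ 2| ≤ powBound ξ := by
  simpa using abs_pow_le_powBound ξ 2

lemma abs_cube_le_powBound (ξ : ℝ) : |ξ ^ 3| ≤ powBound ξ := by
  simpa using abs_pow_le_powBound ξ 3

/-- The value at `ξ` of the polynomial `r₀ + r₁ T + r₂ T²`. -/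
noncomputable def quadVal (ξ : ℝ) (r : Fin 3 → ℤ) : ℝ := r 0 + r 1 * ξ + r 2 * ξ ^ 2

/-- Replacing `y` by its approximation `y₀ (1, ξ, ξ²)` turns the pairing into the value of `r`
at `ξ`. -/
lemma lowerPair_eq (ξ : ℝ) (r : Fin 3 → ℤ) (y : Fin 4 → ℤ) :
    (lowerPair r y : ℝ) = y 0 * quadVal ξ r - (r 1 * err ξ y 1 + r 2 * err ξ y 2) := by
  simp [lowerPair, quadVal, err]; ring

lemma upperPair_sub_eq (ξ : ℝ) (r : Fin 3 → ℤ) (y : Fin 4 → ℤ) :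
    ξ * lowerPair r y - upperPair r y
      = r 0 * err ξ y 1 + r 1 * (err ξ y 2 - ξ * err ξ y 1)
        + r 2 * (err ξ y 3 - ξ * err ξ y 2) := by
  simp [lowerPair, upperPair, err]; ring

lemma abs_mul_le {a b A B : ℝ} (ha : |a| ≤ A) (hb : |b| ≤ B) : |a * b| ≤ A * B := by
  rw [abs_mul]; exact mul_le_mul ha hb (abs_nonneg _) ((abs_nonneg _).trans ha)

lemma abs_add_le' {a b A B : ℝ} (ha : |a| ≤ A) (hb : |b| ≤ B) : |a + b| ≤ A + B :=
  (abs_add_le a b).trans (add_le_add ha hb)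

lemma abs_sub_le' {a b A B : ℝ} (ha : |a| ≤ A) (hb : |b| ≤ B) : |a - b| ≤ A + B :=
  (abs_sub a b).trans (add_le_add ha hb)

lemma abs_lowerPair_le {ξ H : ℝ} {r : Fin 3 → ℤ} (hr : ∀ k, |(r k : ℝ)| ≤ H) (y : Fin 4 → ℤ) :
    |(lowerPair r y : ℝ)| ≤ |(y 0 : ℝ)| * |quadVal ξ r| + 2 * H * ‖err ξ y‖ := by
  rw [lowerPair_eq ξ]
  refine (abs_sub_le' (abs_mul_le le_rfl le_rfl) (abs_add_le' (abs_mul_le (hr 1) (abs_err_le ξ y 1))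
    (abs_mul_le (hr 2) (abs_err_le ξ y 2)))).trans (le_of_eq (by ring))

lemma abs_upperPair_sub_le {ξ H : ℝ} {r : Fin 3 → ℤ} (hr : ∀ k, |(r k : ℝ)| ≤ H)
    (y : Fin 4 → ℤ) :
    |ξ * lowerPair r y - upperPair r y| ≤ 5 * powBound ξ * H * ‖err ξ y‖ := by
  have hH : 0 ≤ H := (abs_nonneg _).trans (hr 0)
  have hD := norm_nonneg (err ξ y)
  have hK := one_le_powBound ξ
  rw [upperPair_sub_eq]
  have h : ∀ k l, |err ξ y k - ξ * err ξ y l| ≤ ‖err ξ y‖ + powBound ξ * ‖err ξ y‖ := fun k l =>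
    abs_sub_le' (abs_err_le ξ y k) (abs_mul_le (abs_self_le_powBound ξ) (abs_err_le ξ y l))
  refine (abs_add_le' (abs_add_le' (abs_mul_le (hr 0) (abs_err_le ξ y 1))
    (abs_mul_le (hr 1) (h 2 1))) (abs_mul_le (hr 2) (h 3 2))).trans ?_
  nlinarith [mul_nonneg hH hD, mul_nonneg (mul_nonneg hH hD) (sub_nonneg.2 hK)]

lemma abs_upperPair_le {ξ H : ℝ} {r : Fin 3 → ℤ} (hr : ∀ k, |(r k : ℝ)| ≤ H) (y : Fin 4 → ℤ) :
    |(upperPair r y : ℝ)| ≤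
      powBound ξ * (|(y 0 : ℝ)| * |quadVal ξ r|) + 7 * powBound ξ * H * ‖err ξ y‖ := by
  have h1 := abs_mul_le (abs_self_le_powBound ξ) (abs_lowerPair_le (ξ := ξ) hr y)
  have h2 := abs_sub_le' h1 (abs_upperPair_sub_le (ξ := ξ) hr y)
  rw [sub_sub_cancel] at h2
  refine h2.trans (le_of_eq (by ring))

lemma abs_hankelCross_le {ξ : ℝ} {x : Fin 4 → ℤ} (h : ‖err ξ x‖ ≤ |(x 0 : ℝ)|) (k : Fin 3) :
    |(hankelCross x k : ℝ)| ≤ 6 * powBound ξ * (|(x 0 : ℝ)| * ‖err ξ x‖) := by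
  have hD := norm_nonneg (err ξ x)
  have hK := one_le_powBound ξ
  have p1 := abs_self_le_powBound ξ
  have p2 := abs_sq_le_powBound ξ
  have p3 := abs_cube_le_powBound ξ
  have t : ∀ {p : ℝ} (l : Fin 4), |p| ≤ powBound ξ →
      |x 0 * p * err ξ x l| ≤ |(x 0 : ℝ)| * powBound ξ * ‖err ξ x‖ := fun l hp =>
    abs_mul_le (abs_mul_le le_rfl hp) (abs_err_le ξ x l)
  have s : ∀ l m : Fin 4, |err ξ x l * err ξ x m| ≤ |(x 0 : ℝ)| * ‖err ξ x‖ := fun l m =>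
    abs_mul_le ((abs_err_le ξ x l).trans h) (abs_err_le ξ x m)
  have hP := mul_nonneg (abs_nonneg (x 0 : ℝ)) hD
  have hPK := mul_nonneg hP (sub_nonneg.2 hK)
  fin_cases k
  · have e : (hankelCross x 0 : ℝ) = (x 0 * ξ ^ 2 * err ξ x 2 + x 0 * ξ ^ 2 * err ξ x 2)
        - (x 0 * ξ ^ 3 * err ξ x 1 + x 0 * ξ * err ξ x 3)
        + (err ξ x 1 * err ξ x 3 - err ξ x 2 * err ξ x 2) := by
      simp [hankelCross, err]; ring
    change |(hankelCross x 0 : ℝ)| ≤ _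
    rw [e]
    refine (abs_add_le' (abs_sub_le' (abs_add_le' (t 2 p2) (t 2 p2)) (abs_add_le' (t 1 p3) (t 3 p1)))
      (abs_sub_le' (s 1 3) (s 2 2))).trans ?_
    nlinarith
  · have e : (hankelCross x 1 : ℝ) = x 0 * 1 * err ξ x 3
        - (x 0 * ξ * err ξ x 2 + x 0 * ξ ^ 2 * err ξ x 1) + err ξ x 1 * err ξ x 2 := by
      simp [hankelCross, err]; ring
    change |(hankelCross x 1 : ℝ)| ≤ _
    rw [e]
    refine (abs_add_le' (abs_sub_le' (t 3 (by simpa using hK)) (abs_add_le' (t 2 p1) (t 1 p2)))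
      (s 1 2)).trans ?_
    nlinarith
  · have e : (hankelCross x 2 : ℝ) = (x 0 * ξ * err ξ x 1 + x 0 * ξ * err ξ x 1)
        - x 0 * 1 * err ξ x 2 - err ξ x 1 * err ξ x 1 := by
      simp [hankelCross, err]; ring
    change |(hankelCross x 2 : ℝ)| ≤ _
    rw [e]
    refine (abs_sub_le' (abs_sub_le' (abs_add_le' (t 1 p1) (t 1 p1)) (t 2 (by simpa using hK)))
      (s 1 1)).trans ?_
    nlinarith

lemma abs_quadVal_hankelCross_le (ξ : ℝ) (x : Fin 4 → ℤ) :
    |quadVal ξ (hankelCross x)| ≤ 4 * powBound ξ * ‖err ξ x‖ ^ 2 := by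
  have hD := norm_nonneg (err ξ x)
  have hK := one_le_powBound ξ
  have p1 := abs_self_le_powBound ξ
  have p2 := abs_sq_le_powBound ξ
  have e : quadVal ξ (hankelCross x) = err ξ x 1 * err ξ x 3 - err ξ x 2 * err ξ x 2
      + ξ * (err ξ x 1 * err ξ x 2) - ξ ^ 2 * (err ξ x 1 * err ξ x 1) := by
    simp [quadVal, hankelCross, err]; ring
  have s : ∀ l m : Fin 4, |err ξ x l * err ξ x m| ≤ ‖err ξ x‖ ^ 2 := fun l m =>
    (abs_mul_le (abs_err_le ξ x l) (abs_err_le ξ x m)).trans (le_of_eq (sq _).symm)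
  rw [e]
  refine (abs_sub_le' (abs_add_le' (abs_sub_le' (s 1 3) (s 2 2)) (abs_mul_le p1 (s 1 2)))
    (abs_mul_le p2 (s 1 1))).trans ?_
  nlinarith [mul_nonneg (sq_nonneg ‖err ξ x‖) (sub_nonneg.2 hK)]

namespace IsMinimalSeq

variable {ξ : ℝ} {x : ℕ → Fin 4 → ℤ}

lemma err_le_coord (hx : IsMinimalSeq ξ x) (i : ℕ) : ‖err ξ (x i)‖ ≤ |(x i 0 : ℝ)| :=
  (hx.err_le_one i).trans ((hx.one_le i).trans (le_abs_self _))

lemma abs_wedge_le (hx : IsMinimalSeq ξ x) {i j : ℕ} (hij : i < j) (k : Fin 6) :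
    |(wedge (x i) (x j) k : ℝ)| ≤ 6 * powBound ξ * (x j 0 * ‖err ξ (x i)‖) := by
  have hK := one_le_powBound ξ
  have hX := hx.pos_real i
  have hXX := hx.lt_real hij
  have hL := hx.err_pos i
  have hLL : ‖err ξ (x j)‖ ≤ ‖err ξ (x i)‖ := (hx.anti hij).le
  have h1 := hx.err_le_one j
  have main : ∀ k l : Fin 4, |(x i k : ℝ) * x j l - x i l * x j k| ≤
      6 * powBound ξ * (x j 0 * ‖err ξ (x i)‖) := by
    intro k l
    have e : (x i k : ℝ) * x j l - x i l * x j k =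
        (x i 0 * ξ ^ (l : ℕ) * err ξ (x j) k - x i 0 * ξ ^ (k : ℕ) * err ξ (x j) l)
        + (x j 0 * ξ ^ (k : ℕ) * err ξ (x i) l - x j 0 * ξ ^ (l : ℕ) * err ξ (x i) k)
        + (err ξ (x j) l * err ξ (x i) k - err ξ (x j) k * err ξ (x i) l) := by
      simp only [err]; ring
    have t1 : ∀ k l : Fin 4, |x i 0 * ξ ^ (l : ℕ) * err ξ (x j) k| ≤
        x j 0 * powBound ξ * ‖err ξ (x i)‖ := fun k l =>
      abs_mul_le (abs_mul_le (by rw [abs_of_pos hX]; exact hXX.le) (abs_pow_le_powBound ξ l))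
        ((abs_err_le _ _ _).trans hLL)
    have t2 : ∀ k l : Fin 4, |x j 0 * ξ ^ (l : ℕ) * err ξ (x i) k| ≤
        x j 0 * powBound ξ * ‖err ξ (x i)‖ := fun k l =>
      abs_mul_le (abs_mul_le (by rw [abs_of_pos (hX.trans hXX)]) (abs_pow_le_powBound ξ l))
        (abs_err_le _ _ _)
    have t3 : ∀ k l : Fin 4, |err ξ (x j) k * err ξ (x i) l| ≤ x j 0 * ‖err ξ (x i)‖ :=
      fun k l => abs_mul_le ((abs_err_le _ _ _).trans (h1.trans (hx.one_le j))) (abs_err_le _ _ _)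
    rw [e]
    refine (abs_add_le' (abs_add_le' (abs_sub_le' (t1 k l) (t1 l k)) (abs_sub_le' (t2 l k) (t2 k l)))
      (abs_sub_le' (t3 l k) (t3 k l))).trans ?_
    nlinarith [mul_nonneg (mul_pos (hX.trans hXX) hL).le (sub_nonneg.2 hK)]
  have e : ∃ a b : Fin 4, (wedge (x i) (x j) k : ℝ) = (x i a : ℝ) * x j b - x i b * x j a := by
    fin_cases k
    exacts [⟨0, 1, by simp [wedge]⟩, ⟨0, 2, by simp [wedge]⟩, ⟨0, 3, by simp [wedge]⟩,
      ⟨1, 2, by simp [wedge]⟩, ⟨1, 3, by simp [wedge]⟩, ⟨2, 3, by simp [wedge]⟩]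
  obtain ⟨a, b, e⟩ := e
  rw [e]; exact main a b

end IsMinimalSeq

/-! ### Non-vanishing along minimal points -/

/-- A vector proportional to each of two independent vectors vanishes. -/
lemma eq_zero_of_wedge_eq_zero {v x y : Fin 4 → ℤ} (hx : ∀ k, wedge v x k = 0)
    (hy : ∀ k, wedge v y k = 0) (hxy : ∃ k, wedge x y k ≠ 0) : v = 0 := by
  have hc : ∀ w : Fin 4 → ℤ, (∀ k, wedge v w k = 0) → ∀ k l, v k * w l = v l * w k := by
    intro w hw
    have h0 := hw 0
    have h1 := hw 1
    have h2 := hw 2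
    have h3 := hw 3
    have h4 := hw 4
    have h5 := hw 5
    simp only [wedge, Matrix.cons_val] at h0 h1 h2 h3 h4 h5
    intro k l
    fin_cases k <;> fin_cases l <;> simp <;> linarith
  have hX := hc x hx
  have hY := hc y hy
  obtain ⟨l, m, hlm⟩ : ∃ l m, x l * y m - x m * y l ≠ 0 := by
    obtain ⟨k, hk⟩ := hxy
    fin_cases k
    exacts [⟨0, 1, hk⟩, ⟨0, 2, hk⟩, ⟨0, 3, hk⟩, ⟨1, 2, hk⟩, ⟨1, 3, hk⟩, ⟨2, 3, hk⟩]
  have hl : v l = 0 := by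
    have : v l * (x l * y m - x m * y l) = 0 := by
      linear_combination x l * hY l m - y l * hX l m
    exact (mul_eq_zero.1 this).resolve_right hlm
  ext k
  have : v k * (x l * y m - x m * y l) = 0 := by
    linear_combination y m * hX k l - x m * hY k l + (x k * y m - x m * y k) * hl
  exact (mul_eq_zero.1 this).resolve_right hlm

/-- The points `x` with `lowerPair r x = upperPair r x = 0` form a plane: any such point depends
linearly on two independent ones. -/
lemma exists_comb_of_pair_eq_zero {r : Fin 3 → ℤ} (hr : ∀ t, (∀ a, t ∣ r a) → IsUnit t)
    {x y z : Fin 4 → ℤ} (hx : lowerPair r x = 0) (hx' : upperPair r x = 0)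
    (hy : lowerPair r y = 0) (hy' : upperPair r y = 0) (hz : lowerPair r z = 0)
    (hz' : upperPair r z = 0) (hxy : ∃ k, wedge x y k ≠ 0) :
    ∃ t a b : ℤ, t ≠ 0 ∧ t • z = a • x + b • y := by
  have hM := dualWedge_primitive hr
  obtain ⟨p, hp⟩ := exists_eq_mul_of_primitive hM (wedge_mul_dualWedge hx hx' hy hy')
  obtain ⟨q, hq⟩ := exists_eq_mul_of_primitive hM (wedge_mul_dualWedge hz hz' hy hy')
  obtain ⟨s, hs⟩ := exists_eq_mul_of_primitive hM (wedge_mul_dualWedge hx hx' hz hz')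
  refine ⟨p, q, s, ?_, ?_⟩
  · rintro rfl
    obtain ⟨k, hk⟩ := hxy
    exact hk (by rw [hp, zero_mul])
  · have hlin : ∀ w k, wedge (p • z - q • x - s • y) w k
        = p * wedge z w k - q * wedge x w k - s * wedge y w k := fun w k => by
      fin_cases k <;> simp [wedge] <;> ring
    have hanti : ∀ u w k, wedge u w k = -wedge w u k := fun u w k => by
      fin_cases k <;> simp [wedge] <;> ring
    have hself : ∀ u k, wedge u u k = 0 := fun u k => by
      fin_cases k <;> simp [wedge] <;> ring
    have h0 : p • z - q • x - s • y = 0 := by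
      refine eq_zero_of_wedge_eq_zero (x := x) (y := y) (fun k => ?_) (fun k => ?_) hxy
      · rw [hlin, hself, hanti z x, hanti y x, hp, hs]; ring
      · rw [hlin, hself, hq, hp]; ring
    rw [sub_sub, sub_eq_zero] at h0
    exact h0

/-- The linear form `a T - b`, applied to two adjacent coordinates of an integer point, in terms of
its value at `ξ` and of the errors of the point. -/
lemma shifted_form_eq (ξ : ℝ) (a b : ℤ) (z : Fin 4 → ℤ) {k m : Fin 4} (hm : (m : ℕ) = k + 1) :
    ((a * z m - b * z k : ℤ) : ℝ) = ξ ^ (k : ℕ) * (z 0 * (a * ξ - b))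
      + (b * err ξ z k - a * err ξ z m) := by
  simp only [err, hm]; push_cast; ring

/-- A geometric progression of four integers with ratio `b / a` in lowest terms starts with a
multiple of `a ^ 3`. -/
lemma abs_cube_le_of_geometric {a b : ℤ} (hab : Int.gcd a b = 1) {x : Fin 4 → ℤ} (h0 : x 0 ≠ 0)
    (h1 : a * x 1 = b * x 0) (h2 : a * x 2 = b * x 1) (h3 : a * x 3 = b * x 2) :
    |a| ^ 3 ≤ |x 0| := by
  have hdvd : a ^ 3 ∣ b ^ 3 * x 0 :=
    ⟨x 3, by linear_combination -b ^ 2 * h1 - a * b * h2 - a ^ 2 * h3⟩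
  have hco : IsCoprime (a ^ 3) (b ^ 3) := (Int.isCoprime_iff_gcd_eq_one.2 hab).pow
  have := Int.le_of_dvd (abs_pos.2 h0) ((abs_dvd_abs _ _).2 (hco.dvd_of_dvd_mul_left hdvd))
  rwa [abs_pow] at this

/-- A nonzero point with vanishing Hankel cross product lies on the cone over the Veronese
curve. -/
lemma exists_of_hankelCross_eq_zero {x : Fin 4 → ℤ} (h0 : 0 < x 0) (h : hankelCross x = 0) :
    ∃ a b : ℤ, a ≠ 0 ∧ a * x 1 = b * x 0 ∧ a * x 2 = b * x 1 ∧ a * x 3 = b * x 2 ∧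
      |a| ^ 3 ≤ x 0 := by
  have e1 := congrFun h 1
  have e2 := congrFun h 2
  simp only [hankelCross, Matrix.cons_val, Pi.zero_apply] at e1 e2
  obtain ⟨g, a, b, hg, hab, ha, hb⟩ := Int.exists_gcd_one' (Int.gcd_pos_of_ne_zero_left (x 1) h0.ne')
  have hg0 : (g : ℤ) ≠ 0 := by exact_mod_cast hg.ne'
  have ha0 : a ≠ 0 := by rintro rfl; simp at ha; omega
  have h1 : a * x 1 = b * x 0 := by rw [ha, hb]; ring
  have h2 : a * x 2 = b * x 1 := by
    have : (g : ℤ) * (a * x 2 - b * x 1) = 0 := by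
      linear_combination e2 - x 2 * ha + x 1 * hb
    have := (mul_eq_zero.1 this).resolve_left hg0
    linarith
  have h3 : a * x 3 = b * x 2 := by
    have : (g : ℤ) * (a * x 3 - b * x 2) = 0 := by
      linear_combination -e1 - x 3 * ha + x 2 * hb
    have := (mul_eq_zero.1 this).resolve_left hg0
    linarith
  refine ⟨a, b, ha0, h1, h2, h3, ?_⟩
  have := abs_cube_le_of_geometric hab h0.ne' h1 h2 h3
  rwa [abs_of_pos h0] at this

/-- The dual wedge of `r` is at least of the order of the square of `r`. The entry
`r₁² - r₀ r₂` may be small, but then `r₀ r₂` is large. -/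
lemma exists_two_mul_dualWedge_ge (r : Fin 3 → ℤ) (k : Fin 3) :
    ∃ a, (r k : ℝ) ^ 2 ≤ 2 * |(dualWedge r a : ℝ)| := by
  fin_cases k
  · refine ⟨5, ?_⟩
    simp [dualWedge]; nlinarith [abs_mul_abs_self (r 0 : ℝ)]
  · have : (r 1 : ℝ) ^ 2 ≤ |(dualWedge r 2 : ℝ)| + |(dualWedge r 3 : ℝ)| := by
      refine le_trans (le_of_eq ?_) ((le_abs_self _).trans (abs_add_le _ _))
      simp [dualWedge]; ring
    rcases le_total |(dualWedge r 2 : ℝ)| |(dualWedge r 3 : ℝ)| with h | h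
    · exact ⟨3, by simpa using (by linarith : (r 1 : ℝ) ^ 2 ≤ 2 * |(dualWedge r 3 : ℝ)|)⟩
    · exact ⟨2, by simpa using (by linarith : (r 1 : ℝ) ^ 2 ≤ 2 * |(dualWedge r 2 : ℝ)|)⟩
  · refine ⟨0, ?_⟩
    simp [dualWedge]; nlinarith [abs_mul_abs_self (r 2 : ℝ)]

lemma abs_dualWedge_le {r : Fin 3 → ℤ} {H : ℝ} (hr : ∀ k, |(r k : ℝ)| ≤ H) (a : Fin 6) :
    |(dualWedge r a : ℝ)| ≤ 2 * H ^ 2 := by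
  have h : ∀ k l, |(r k : ℝ) * r l| ≤ H ^ 2 := fun k l =>
    (abs_mul_le (hr k) (hr l)).trans (le_of_eq (sq H).symm)
  have hH := sq_nonneg H
  have h2 := abs_sub_le' (h 1 1) (h 0 2)
  have h00 := h 0 0
  have h01 := h 0 1
  have h02 := h 0 2
  have h12 := h 1 2
  have h22 := h 2 2
  fin_cases a <;> simp only [dualWedge, Fin.isValue, Fin.mk_zero, Fin.mk_one,
    Fin.reduceFinMk, Matrix.cons_val, Int.cast_mul, Int.cast_neg, Int.cast_sub, abs_neg] <;> linarith

lemma log_mul_mul {c u v : ℝ} (hc : 0 < c) (hu : 0 < u) (hv : 0 < v) :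
    Real.log (c * (u * v)) = Real.log c + Real.log u + Real.log v := by
  rw [Real.log_mul hc.ne' (mul_pos hu hv).ne', Real.log_mul hu.ne' hv.ne', add_assoc]

namespace IsMinimalSeq

variable {ξ : ℝ} {x : ℕ → Fin 4 → ℤ}

lemma exists_log_gt (hx : IsMinimalSeq ξ x) (C : ℝ) :
    ∃ N, ∀ i, N ≤ i → C < Real.log (x i 0) := by
  have h1 : ∀ i : ℕ, (i : ℤ) ≤ x i 0 := fun i => by
    induction i with
    | zero => exact (hx.pos 0).le
    | succ n ih => have := hx.mono (Nat.lt_succ_self n); simp at this; push_cast; omega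
  have h2 : Tendsto (fun i : ℕ => Real.log (x i 0)) atTop atTop :=
    Real.tendsto_log_atTop.comp (tendsto_atTop_mono (fun i => by exact_mod_cast h1 i)
      tendsto_natCast_atTop_atTop)
  exact eventually_atTop.1 (h2.eventually_gt_atTop C)

lemma log_le_log (hx : IsMinimalSeq ξ x) {i j : ℕ} (h : i ≤ j) :
    Real.log (x i 0) ≤ Real.log (x j 0) := by
  refine Real.log_le_log (hx.pos_real i) ?_
  exact_mod_cast hx.mono.monotone h

/-- For an exponent above `1/3`, the large minimal points are off the cone over the Veronese
curve: a linear form vanishing along such a point would be a small integer at the preceding one. -/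
lemma hankelCross_ne_zero (hx : IsMinimalSeq ξ x) {l K : ℝ}
    (hK : ∀ i, Real.log ‖err ξ (x i)‖ ≤ K - l * Real.log (x (i + 1) 0)) (hl : 1 / 3 < l) :
    ∃ N, ∀ i, N ≤ i → hankelCross (x i) ≠ 0 := by
  have hP := one_le_powBound ξ
  set P := powBound ξ with hPdef
  obtain ⟨N, hN⟩ := hx.exists_log_gt ((Real.log (64 * P ^ 3) + 3 * K) / (3 * l - 1))
  refine ⟨N + 1, fun i hi h => ?_⟩
  obtain ⟨n, rfl⟩ : ∃ n, i = n + 1 := ⟨i - 1, by omega⟩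
  obtain ⟨a, b, ha, h1, h2, h3, hcube⟩ := exists_of_hankelCross_eq_zero (hx.pos _) h
  have hX := hx.pos_real n
  have hX1 := hx.pos_real (n + 1)
  have hlt := hx.lt_real (Nat.lt_succ_self n)
  have hL := hx.err_pos n
  have hLL : ‖err ξ (x (n + 1))‖ ≤ ‖err ξ (x n)‖ := (hx.anti (Nat.lt_succ_self n)).le
  have hL1 := hx.err_le_one (n + 1)
  have hX1' := hx.one_le (n + 1)
  set A : ℝ := |(a : ℝ)| with hA
  have hA0 : 0 ≤ A := abs_nonneg _
  set D : ℝ := |(a : ℝ) * ξ - b| with hD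
  have hd : x (n + 1) 0 * D ≤ A * ‖err ξ (x (n + 1))‖ := by
    have e : (x (n + 1) 0 : ℝ) * ((a : ℝ) * ξ - b) = a * err ξ (x (n + 1)) 1 := by
      have : (a : ℝ) * x (n + 1) 1 = b * x (n + 1) 0 := by exact_mod_cast h1
      simp only [err, Fin.val_one, pow_one]; linear_combination this
    have := congrArg abs e
    rw [abs_mul, abs_mul, abs_of_pos hX1] at this
    rw [this]
    gcongr; exact abs_err_le _ _ _
  have hd1 : x n 0 * D ≤ A * ‖err ξ (x n)‖ :=
    calc x n 0 * D ≤ x (n + 1) 0 * D := mul_le_mul_of_nonneg_right hlt.le (abs_nonneg _)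
      _ ≤ _ := hd.trans (mul_le_mul_of_nonneg_left hLL hA0)
  have hd2 : D ≤ A := by
    have : D ≤ x (n + 1) 0 * D := le_mul_of_one_le_left (abs_nonneg _) hX1'
    nlinarith
  have hb : |(b : ℝ)| ≤ A * (P + 1) := by
    have : (b : ℝ) = a * ξ - (a * ξ - b) := by ring
    rw [this]
    refine (abs_sub_le' (abs_mul_le le_rfl (abs_self_le_powBound ξ)) le_rfl).trans ?_
    change A * P + D ≤ _
    linarith
  have hsmall : ∀ k : Fin 4, ∀ m : Fin 4, (m : ℕ) = k + 1 → a * x n m - b * x n k ≠ 0 →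
      1 ≤ 4 * P * (A * ‖err ξ (x n)‖) := by
    intro k m hm hne
    have e := shifted_form_eq ξ a b (x n) hm
    have h1 : (1 : ℝ) ≤ |((a * x n m - b * x n k : ℤ) : ℝ)| := by
      exact_mod_cast Int.one_le_abs hne
    rw [e] at h1
    have h2 : |(x n 0 : ℝ) * (a * ξ - b)| ≤ A * ‖err ξ (x n)‖ := by
      rw [abs_mul, abs_of_pos hX]; exact hd1
    have h3 := h1.trans (abs_add_le' (abs_mul_le (abs_pow_le_powBound ξ k) h2)
      (abs_sub_le' (abs_mul_le hb (abs_err_le ξ (x n) k)) (abs_mul_le le_rfl (abs_err_le ξ (x n) m))))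
    have := mul_nonneg hA0 hL.le
    refine h3.trans ?_
    change P * (A * ‖err ξ (x n)‖) + (A * (P + 1) * ‖err ξ (x n)‖ + A * ‖err ξ (x n)‖) ≤ _
    nlinarith
  have hbig : 1 ≤ 4 * P * (A * ‖err ξ (x n)‖) := by
    by_contra hcon
    have g : ∀ k : Fin 4, ∀ m : Fin 4, (m : ℕ) = k + 1 → a * x n m = b * x n k := fun k m hm => by
      by_contra hne
      exact hcon (hsmall k m hm (sub_ne_zero.2 hne))
    have g1 := g 0 1 rfl
    have g2 := g 1 2 rfl
    have g3 := g 2 3 rfl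
    have hprop : x (n + 1) 0 • x n + (-x n 0) • x (n + 1) = 0 := by
      ext k
      have : ∀ u : ℤ, ∀ j : ℕ, a ^ j * u = 0 → u = 0 := fun u j hu =>
        (mul_eq_zero.1 hu).resolve_left (pow_ne_zero _ ha)
      simp only [Pi.add_apply, Pi.smul_apply, smul_eq_mul, Pi.zero_apply]
      fin_cases k
      · simp; ring
      · refine this _ 1 ?_
        change a ^ 1 * (x (n + 1) 0 * x n 1 + -x n 0 * x (n + 1) 1) = 0
        linear_combination x (n + 1) 0 * g1 - x n 0 * h1
      · refine this _ 2 ?_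
        change a ^ 2 * (x (n + 1) 0 * x n 2 + -x n 0 * x (n + 1) 2) = 0
        linear_combination x (n + 1) 0 * (a * g2 + b * g1) - x n 0 * (a * h2 + b * h1)
      · refine this _ 3 ?_
        change a ^ 3 * (x (n + 1) 0 * x n 3 + -x n 0 * x (n + 1) 3) = 0
        linear_combination x (n + 1) 0 * (a ^ 2 * g3 + a * b * g2 + b ^ 2 * g1)
          - x n 0 * (a ^ 2 * h3 + a * b * h2 + b ^ 2 * h1)
    have := (hx.eq_zero_of_comb_eq_zero (Nat.lt_succ_self n) hprop).1
    have := hx.pos (n + 1)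
    omega
  have hc : A ^ 3 ≤ x (n + 1) 0 := by rw [hA]; exact_mod_cast hcube
  have hcubed : 1 ≤ 64 * P ^ 3 * (x (n + 1) 0 * ‖err ξ (x n)‖ ^ 3) := by
    calc (1 : ℝ) ≤ (4 * P * (A * ‖err ξ (x n)‖)) ^ 3 := one_le_pow₀ hbig
      _ = 64 * P ^ 3 * (A ^ 3 * ‖err ξ (x n)‖ ^ 3) := by ring
      _ ≤ _ := by gcongr
  have hlog := Real.log_nonneg hcubed
  rw [log_mul_mul (by positivity) hX1 (by positivity), Real.log_pow] at hlog
  have h5 := hN (n + 1) (by omega)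
  rw [div_lt_iff₀ (by linarith)] at h5
  have h6 := hK n
  push_cast at hlog
  linarith

/-- Three consecutive independent minimal points `x n`, `x (n+1)`, `x (n+2)`: the Hankel cross
product of the middle one does not annihilate the plane of the last two. Otherwise that plane is
cut out by a primitive `r` and its shift, so its height is about the square of the height of `r`;
comparing this with the bounds for `r` at `x n` and `x (n+1)` gives `l² + 2l ≤ 1`. -/
lemma pair_ne_zero (hx : IsMinimalSeq ξ x) {l K : ℝ}
    (hK : ∀ i, Real.log ‖err ξ (x i)‖ ≤ K - l * Real.log (x (i + 1) 0)) (hl : 1 / 3 < l)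
    (hl1 : l ≤ 1) (hl2 : 1 < l ^ 2 + 2 * l) :
    ∃ N, ∀ n, N ≤ n → (¬∃ t a b : ℤ, t ≠ 0 ∧ t • x n = a • x (n + 1) + b • x (n + 2)) →
      lowerPair (hankelCross (x (n + 1))) (x (n + 2)) ≠ 0 ∨
        upperPair (hankelCross (x (n + 1))) (x (n + 2)) ≠ 0 := by
  have hP := one_le_powBound ξ
  set P := powBound ξ with hPdef
  obtain ⟨N₁, hN₁⟩ := hx.hankelCross_ne_zero hK hl
  -- this threshold is contradicted by combining the four logarithmic estimates below
  obtain ⟨N₂, hN₂⟩ := hx.exists_log_gt (((1 + l) * (Real.log (12 * P) + 2 * Real.log (9 * P) + K + 2 * K)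
    + (1 - l) * (Real.log 6 + 2 * Real.log (6 * P) + K)) / (2 * (l ^ 2 + 2 * l - 1)))
  refine ⟨max N₁ N₂, fun n hn hind => ?_⟩
  by_contra hcon
  push Not at hcon
  obtain ⟨hlow, hup⟩ := hcon
  have hh := hN₁ (n + 1) (by omega)
  obtain ⟨m, r, hm, hmr, hprim⟩ := exists_primitive hh
  have hlowm : ∀ y, lowerPair (hankelCross (x (n + 1))) y = m * lowerPair r y := fun y => by
    simp only [lowerPair, hmr]; ring
  have hupm : ∀ y, upperPair (hankelCross (x (n + 1))) y = m * upperPair r y := fun y => by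
    simp only [upperPair, hmr]; ring
  have y1 : lowerPair r (x (n + 2)) = 0 := by
    rw [hlowm] at hlow; exact (mul_eq_zero.1 hlow).resolve_left hm
  have y2 : upperPair r (x (n + 2)) = 0 := by
    rw [hupm] at hup; exact (mul_eq_zero.1 hup).resolve_left hm
  have x1 : lowerPair r (x (n + 1)) = 0 := by
    have := lowerPair_hankelCross_self (x (n + 1))
    rw [hlowm] at this; exact (mul_eq_zero.1 this).resolve_left hm
  have x2 : upperPair r (x (n + 1)) = 0 := by
    have := upperPair_hankelCross_self (x (n + 1))
    rw [hupm] at this; exact (mul_eq_zero.1 this).resolve_left hm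
  have hw := hx.wedge_ne_zero (Nat.lt_succ_self (n + 1))
  obtain ⟨k₀, hk₀⟩ := Finite.exists_max fun k => |(r k : ℝ)|
  set H : ℝ := |(r k₀ : ℝ)| with hH
  have hX0 := hx.pos_real n
  have hX1 := hx.pos_real (n + 1)
  have hX2 := hx.pos_real (n + 2)
  have hX01 := hx.lt_real (Nat.lt_succ_self n)
  have hL0 := hx.err_pos n
  have hL1 := hx.err_pos (n + 1)
  have hL01 : ‖err ξ (x (n + 1))‖ ≤ ‖err ξ (x n)‖ := (hx.anti (Nat.lt_succ_self n)).le
  have hHpos : 0 < H := by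
    obtain ⟨k, hk⟩ := Function.ne_iff.mp hh
    refine lt_of_lt_of_le ?_ (hk₀ k)
    rw [abs_pos]
    intro h0
    have h0' : r k = 0 := by exact_mod_cast h0
    exact hk (by rw [hmr, h0']; simp)
  have one_le_of : ∀ c : ℤ, c ≠ 0 → (1 : ℝ) ≤ |(c : ℝ)| := fun c hc => by
    exact_mod_cast Int.one_le_abs hc
  -- the wedge of the two points and the dual wedge of `r` are proportional and both primitive
  have hb : H ^ 2 ≤ 12 * P * (x (n + 2) 0 * ‖err ξ (x (n + 1))‖) := by
    obtain ⟨c, hc⟩ := exists_eq_mul_of_primitive (dualWedge_primitive hprim)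
      (wedge_mul_dualWedge x1 x2 y1 y2)
    have hc0 : c ≠ 0 := by
      rintro rfl
      obtain ⟨k, hk⟩ := hw
      exact hk (by rw [hc, zero_mul])
    obtain ⟨a, ha⟩ := exists_two_mul_dualWedge_ge r k₀
    have h1 := hx.abs_wedge_le (Nat.lt_succ_self (n + 1)) a
    rw [hc, Int.cast_mul, abs_mul] at h1
    have h2 := le_mul_of_one_le_left (abs_nonneg (dualWedge r a : ℝ)) (one_le_of c hc0)
    rw [hH, sq_abs]
    nlinarith
  have ha : x (n + 2) 0 * ‖err ξ (x (n + 1))‖ ≤ 6 * H ^ 2 := by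
    obtain ⟨c, hc⟩ := exists_eq_mul_of_primitive (hx.wedge_primitive (n + 1))
      (fun a b => (by
        have := wedge_mul_dualWedge x1 x2 y1 y2 b a
        linarith : dualWedge r a * wedge (x (n + 1)) (x (n + 1 + 1)) b
          = dualWedge r b * wedge (x (n + 1)) (x (n + 1 + 1)) a))
    have hc0 : c ≠ 0 := by
      rintro rfl
      obtain ⟨a, ha⟩ := exists_two_mul_dualWedge_ge r k₀
      rw [hc, zero_mul, ← sq_abs] at ha
      have := pow_pos hHpos 2
      simp at ha
      rw [hH, ha] at hHpos
      simp at hHpos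
    obtain ⟨a, -, ha⟩ := hx.exists_wedge_ge (Nat.lt_succ_self (n + 1))
    have h1 := abs_dualWedge_le hk₀ a
    rw [hc, Int.cast_mul, abs_mul] at h1
    have h2 := le_mul_of_one_le_left (abs_nonneg (wedge (x (n + 1)) (x (n + 1 + 1)) a : ℝ))
      (one_le_of c hc0)
    change x (n + 2) 0 * ‖err ξ (x (n + 1))‖ / 3 ≤ _ at ha
    linarith
  have hc : H ≤ 6 * P * (x (n + 1) 0 * ‖err ξ (x (n + 1))‖) := by
    have h1 := abs_hankelCross_le (hx.err_le_coord (n + 1)) k₀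
    rw [hmr, Int.cast_mul, abs_mul, abs_of_pos hX1] at h1
    exact (le_mul_of_one_le_left (abs_nonneg _) (one_le_of m hm)).trans h1
  have hd : 1 ≤ 9 * P * (H * ‖err ξ (x n)‖) := by
    have hq : x n 0 * |quadVal ξ r| ≤ 2 * H * ‖err ξ (x n)‖ := by
      have e : (x (n + 1) 0 : ℝ) * quadVal ξ r
          = r 1 * err ξ (x (n + 1)) 1 + r 2 * err ξ (x (n + 1)) 2 := by
        have := lowerPair_eq ξ r (x (n + 1))
        rw [x1] at this; push_cast at this; linarith
      have h1 : x (n + 1) 0 * |quadVal ξ r| ≤ 2 * H * ‖err ξ (x (n + 1))‖ := by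
        have h2 := congrArg abs e
        rw [abs_mul, abs_of_pos hX1] at h2
        rw [h2]
        exact (abs_add_le' (abs_mul_le (hk₀ 1) (abs_err_le _ _ _))
          (abs_mul_le (hk₀ 2) (abs_err_le _ _ _))).trans (le_of_eq (by ring))
      calc x n 0 * |quadVal ξ r| ≤ x (n + 1) 0 * |quadVal ξ r| := by gcongr
        _ ≤ _ := h1
        _ ≤ _ := by gcongr
    have hHL := mul_pos hHpos hL0
    have hne : lowerPair r (x n) ≠ 0 ∨ upperPair r (x n) ≠ 0 := by
      by_contra hcon
      push Not at hcon
      exact hind (exists_comb_of_pair_eq_zero hprim x1 x2 y1 y2 hcon.1 hcon.2 hw)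
    rcases hne with h | h
    · have h1 := (one_le_of _ h).trans (abs_lowerPair_le (ξ := ξ) hk₀ (x n))
      rw [abs_of_pos hX0] at h1
      nlinarith
    · have h1 := (one_le_of _ h).trans (abs_upperPair_le (ξ := ξ) hk₀ (x n))
      rw [abs_of_pos hX0] at h1
      nlinarith
  have la := Real.log_le_log (by positivity) ha
  have lb := Real.log_le_log (by positivity) hb
  have lc := Real.log_le_log (by positivity) hc
  have ld := Real.log_nonneg hd
  rw [Real.log_mul hX2.ne' hL1.ne', Real.log_mul (by norm_num) (by positivity), Real.log_pow] at la
  rw [log_mul_mul (by positivity) hX2 hL1, Real.log_pow] at lb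
  rw [log_mul_mul (by positivity) hX1 hL1] at lc
  rw [log_mul_mul (by positivity) hHpos hL0] at ld
  have hn2 := hN₂ (n + 1) (by omega)
  rw [div_lt_iff₀ (by linarith)] at hn2
  have k0 := hK n
  have k1 := hK (n + 1)
  push_cast at la lb lc ld
  change Real.log ‖err ξ (x (n + 1))‖ ≤ K - l * Real.log (x (n + 2) 0) at k1
  have i1 : (1 + l) * Real.log (x (n + 2) 0) ≤
      Real.log 6 + 2 * Real.log (6 * P) + K + 2 * Real.log (x (n + 1) 0) := by linarith
  have i2 : 0 ≤ Real.log (12 * P) + 2 * Real.log (9 * P) + K + 2 * K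
      + (1 - l) * Real.log (x (n + 2) 0) - 2 * l * Real.log (x (n + 1) 0) := by linarith
  have i3 := mul_le_mul_of_nonneg_left i1 (sub_nonneg.2 hl1)
  have i4 := mul_nonneg (by linarith : 0 ≤ 1 + l) i2
  nlinarith

end IsMinimalSeq

/-! ### Subspaces spanned by minimal points -/

/-- An integer point, seen in `ℚ⁴`. -/
def ratPt (x : Fin 4 → ℤ) : Fin 4 → ℚ := fun k => (x k : ℚ)

lemma exists_comb_of_ratPt_mem {x y z : Fin 4 → ℤ}
    (h : ratPt z ∈ Submodule.span ℚ {ratPt x, ratPt y}) :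
    ∃ t a b : ℤ, t ≠ 0 ∧ t • z = a • x + b • y := by
  obtain ⟨α, β, hαβ⟩ := Submodule.mem_span_pair.1 h
  refine ⟨α.den * β.den, α.num * β.den, β.num * α.den, by
    exact_mod_cast mul_ne_zero α.den_nz β.den_nz, ?_⟩
  ext k
  have h1 := congrFun hαβ k
  simp only [Pi.add_apply, Pi.smul_apply, smul_eq_mul, ratPt] at h1
  have hα := Rat.mul_den_eq_num α
  have hβ := Rat.mul_den_eq_num β
  have : ((α.den * β.den * z k : ℤ) : ℚ)
      = ((α.num * β.den * x k + β.num * α.den * y k : ℤ) : ℚ) := by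
    push_cast
    rw [← h1, ← hα, ← hβ]; ring
  simp only [Pi.add_apply, Pi.smul_apply, smul_eq_mul]
  exact_mod_cast this

lemma ratPt_mem_of_comb {x y z : Fin 4 → ℤ} {t a b : ℤ} (ht : t ≠ 0)
    (h : t • z = a • x + b • y) : ratPt z ∈ Submodule.span ℚ {ratPt x, ratPt y} := by
  refine Submodule.mem_span_pair.2 ⟨(a : ℚ) / t, (b : ℚ) / t, ?_⟩
  have htQ : (t : ℚ) ≠ 0 := by exact_mod_cast ht
  ext k
  have h1 : (t : ℚ) * z k = a * x k + b * y k := by exact_mod_cast congrFun h k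
  simp only [Pi.add_apply, Pi.smul_apply, smul_eq_mul, ratPt]
  field_simp
  linarith

/-- A nonzero determinant of four integer points, expanded after replacing all but the first
column by errors. -/
lemma one_le_of_linearIndependent {ξ Xm Lm : ℝ} (y : Fin 4 → Fin 4 → ℤ)
    (hy : LinearIndependent ℚ fun a => ratPt (y a)) (hL : 0 < Lm) (hX : ∀ a, |(y a 0 : ℝ)| ≤ Xm)
    (hLy : ∀ a, Lm ≤ ‖err ξ (y a)‖) : 1 ≤ 24 * (Xm / Lm * ∏ a, ‖err ξ (y a)‖) := by
  set M : Matrix (Fin 4) (Fin 4) ℤ := Matrix.of y with hM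
  have hdet : M.det ≠ 0 := by
    intro h0
    have h1 : LinearIndependent ℚ (M.map (Int.castRingHom ℚ)).row := hy
    rw [Matrix.linearIndependent_rows_iff_isUnit, Matrix.isUnit_iff_isUnit_det] at h1
    have h2 : (M.map (Int.castRingHom ℚ)).det = (Int.castRingHom ℚ) M.det :=
      (RingHom.map_det _ _).symm
    rw [h2, h0] at h1
    simp at h1
  set E : Matrix (Fin 4) (Fin 4) ℝ :=
    Matrix.of fun a b => if b = 0 then (y a 0 : ℝ) else err ξ (y a) b with hE
  set U : Matrix (Fin 4) (Fin 4) ℝ :=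
    !![1, ξ, ξ ^ 2, ξ ^ 3; 0, -1, 0, 0; 0, 0, -1, 0; 0, 0, 0, -1] with hU
  have hEU : E = M.map (Int.castRingHom ℝ) * U := by
    ext a b
    fin_cases b <;> simp [hE, hU, hM, Matrix.mul_apply, Fin.sum_univ_four, err] <;> ring
  have hUdet : U.det = -1 := by
    have : U.BlockTriangular id := by
      intro i j hij
      fin_cases i <;> fin_cases j <;> simp_all
    rw [Matrix.det_of_isUpperTriangular this]
    simp [Fin.prod_univ_four, hU]
  have h1 : 1 ≤ |E.det| := by
    have h2 : (M.map (Int.castRingHom ℝ)).det = (Int.castRingHom ℝ) M.det :=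
      (RingHom.map_det _ _).symm
    rw [hEU, Matrix.det_mul, hUdet, h2, mul_neg_one, abs_neg]
    have := Int.one_le_abs hdet
    simp only [eq_intCast]
    exact_mod_cast this
  refine h1.trans ?_
  have hXm : 0 ≤ Xm := (abs_nonneg _).trans (hX 0)
  have hterm : ∀ σ : Equiv.Perm (Fin 4),
      |∏ i, E (σ i) i| ≤ Xm / Lm * ∏ a, ‖err ξ (y a)‖ := by
    intro σ
    rw [← Equiv.prod_comp σ fun a => ‖err ξ (y a)‖, Finset.abs_prod,
      Fin.prod_univ_succ fun i => |E (σ i) i|, Fin.prod_univ_succ fun i => ‖err ξ (y (σ i))‖]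
    refine (mul_le_mul (b := Xm / Lm * ‖err ξ (y (σ 0))‖) ?_ ?_
      (Finset.prod_nonneg fun _ _ => abs_nonneg _)
      (mul_nonneg (div_nonneg hXm hL.le) (norm_nonneg _))).trans_eq (mul_assoc _ _ _)
    · have h3 : Xm ≤ Xm / Lm * ‖err ξ (y (σ 0))‖ := by
        rw [div_mul_eq_mul_div, le_div_iff₀ hL]
        exact mul_le_mul_of_nonneg_left (hLy _) hXm
      refine le_trans ?_ h3
      simpa [hE] using hX (σ 0)
    · refine Finset.prod_le_prod (fun _ _ => abs_nonneg _) fun i _ => ?_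
      simpa [hE] using abs_err_le ξ (y (σ i.succ)) i.succ
  rw [Matrix.det_apply]
  refine (Finset.abs_sum_le_sum_abs _ _).trans ?_
  calc ∑ σ : Equiv.Perm (Fin 4), |Equiv.Perm.sign σ • ∏ i, E (σ i) i|
      ≤ ∑ _σ : Equiv.Perm (Fin 4), Xm / Lm * ∏ a, ‖err ξ (y a)‖ := by
        refine Finset.sum_le_sum fun σ _ => ?_
        rcases Int.units_eq_one_or (Equiv.Perm.sign σ) with h | h <;> rw [h] <;>
          simpa using hterm σ
    _ = _ := by
        rw [Finset.sum_const, Finset.card_univ, Fintype.card_perm, Fintype.card_fin, nsmul_eq_mul]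
        norm_num [Nat.factorial]

namespace IsMinimalSeq

variable {ξ : ℝ} {x : ℕ → Fin 4 → ℤ}

lemma linearIndependent_pair (hx : IsMinimalSeq ξ x) {i j : ℕ} (hij : i < j) :
    LinearIndependent ℚ ![ratPt (x i), ratPt (x j)] := by
  rw [LinearIndependent.pair_iff]
  intro s t hst
  have h0 : (s.num * t.den) • x i + (t.num * s.den) • x j = 0 := by
    ext k
    have h1 := congrFun hst k
    simp only [Pi.add_apply, Pi.smul_apply, smul_eq_mul, ratPt, Pi.zero_apply] at h1
    have hs := Rat.mul_den_eq_num s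
    have ht := Rat.mul_den_eq_num t
    have : ((s.num * t.den * x i k + t.num * s.den * x j k : ℤ) : ℚ) = 0 := by
      push_cast
      rw [← hs, ← ht]
      linear_combination (s.den * t.den : ℚ) * h1
    simp only [Pi.add_apply, Pi.smul_apply, smul_eq_mul, Pi.zero_apply]
    exact_mod_cast this
  obtain ⟨h1, h2⟩ := hx.eq_zero_of_comb_eq_zero hij h0
  simpa using And.intro h1 h2

lemma finrank_plane (hx : IsMinimalSeq ξ x) {i j : ℕ} (hij : i < j) :
    Module.finrank ℚ (Submodule.span ℚ {ratPt (x i), ratPt (x j)}) = 2 := by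
  have := finrank_span_eq_card (hx.linearIndependent_pair hij)
  rwa [Matrix.range_cons_cons_empty, Fintype.card_fin] at this

lemma plane_eq (hx : IsMinimalSeq ξ x) {i j i' j' : ℕ} (hij : i < j) (hij' : i' < j')
    (hi : ratPt (x i) ∈ Submodule.span ℚ {ratPt (x i'), ratPt (x j')})
    (hj : ratPt (x j) ∈ Submodule.span ℚ {ratPt (x i'), ratPt (x j')}) :
    Submodule.span ℚ {ratPt (x i), ratPt (x j)}
      = Submodule.span ℚ {ratPt (x i'), ratPt (x j')} := by
  refine Submodule.eq_of_le_of_finrank_eq ?_ (by rw [hx.finrank_plane hij, hx.finrank_plane hij'])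
  rw [Submodule.span_le]
  rintro v (rfl | rfl)
  exacts [hi, hj]

/-- No proper subspace contains all late minimal points, as `1, ξ, ξ², ξ³` are linearly
independent over `ℚ`. -/
lemma exists_notMem (hx : IsMinimalSeq ξ x) (hξ : Transcendental ℚ ξ)
    {W : Submodule ℚ (Fin 4 → ℚ)} (hW : W ≠ ⊤) (N : ℕ) : ∃ k, N ≤ k ∧ ratPt (x k) ∉ W := by
  by_contra hcon
  push Not at hcon
  obtain ⟨f, hf0, hf⟩ := Submodule.exists_le_ker_of_lt_top W (lt_top_iff_ne_top.2 hW)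
  set c : Fin 4 → ℚ := fun k => f (Pi.single k 1) with hc
  have hfc : ∀ v, f v = ∑ k, v k * c k := fun v => by
    rw [LinearMap.pi_apply_eq_sum_univ]
    refine Finset.sum_congr rfl fun k _ => ?_
    rw [smul_eq_mul, hc]
    congr 2
    ext j
    simp [Pi.single_apply, eq_comm]
  set S : ℝ := ∑ k : Fin 4, (c k : ℝ) * ξ ^ (k : ℕ) with hS
  have hsmall : ∀ i, N ≤ i → x i 0 * |S| ≤ ∑ k, |(c k : ℝ)| := by
    intro i hi
    have h1 : f (ratPt (x i)) = 0 := hf (hcon i hi)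
    rw [hfc] at h1
    have h2 : ∑ k, (x i k : ℝ) * c k = 0 := by
      simp only [ratPt] at h1
      exact_mod_cast congrArg (fun q : ℚ => (q : ℝ)) h1
    have h3 : x i 0 * S = ∑ k, (c k : ℝ) * err ξ (x i) k := by
      rw [← add_zero (∑ k, (c k : ℝ) * err ξ (x i) k), ← h2, ← Finset.sum_add_distrib, hS,
        Finset.mul_sum]
      refine Finset.sum_congr rfl fun k _ => ?_
      simp only [err]; ring
    have h4 := congrArg abs h3
    rw [abs_mul, abs_of_pos (hx.pos_real i)] at h4
    rw [h4]
    refine (Finset.abs_sum_le_sum_abs _ _).trans (Finset.sum_le_sum fun k _ => ?_)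
    rw [abs_mul]
    exact mul_le_of_le_one_right (abs_nonneg _) ((abs_err_le _ _ _).trans (hx.err_le_one i))
  have hS0 : S = 0 := by
    by_contra hne
    have hp : 0 < |S| := abs_pos.2 hne
    obtain ⟨N', hN'⟩ := hx.exists_log_gt ((∑ k, |(c k : ℝ)|) / |S|)
    have h1 := hN' (max N N') (le_max_right _ _)
    have h2 := Real.log_le_sub_one_of_pos (hx.pos_real (max N N'))
    have h3 := hsmall (max N N') (le_max_left _ _)
    rw [div_lt_iff₀ hp] at h1
    nlinarith
  set p : ℚ[X] := ∑ k : Fin 4, C (c k) * X ^ (k : ℕ) with hp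
  have hpe : aeval ξ p = 0 := by
    rw [← hS0, hp, map_sum, hS]
    refine Finset.sum_congr rfl fun k _ => ?_
    simp
  have hp0 : p = 0 := by
    by_contra hne
    exact hξ ⟨p, hne, hpe⟩
  refine hf0 (LinearMap.ext fun v => ?_)
  rw [hfc]
  refine Finset.sum_eq_zero fun k _ => ?_
  have : p.coeff k = c k := by
    rw [hp]
    simp only [finsetSum_coeff, coeff_C_mul, coeff_X_pow]
    simp [Fin.val_inj]
  rw [← this, hp0]
  simp

lemma exists_first_notMem (hx : IsMinimalSeq ξ x) (hξ : Transcendental ℚ ξ)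
    {W : Submodule ℚ (Fin 4 → ℚ)} (hW : W ≠ ⊤) (N : ℕ) :
    ∃ k, N ≤ k ∧ ratPt (x k) ∉ W ∧ ∀ n, N ≤ n → n < k → ratPt (x n) ∈ W := by
  classical
  have h := hx.exists_notMem hξ hW N
  refine ⟨Nat.find h, (Nat.find_spec h).1, (Nat.find_spec h).2, fun n hn hlt => ?_⟩
  have := Nat.find_min h hlt
  push Not at this
  exact this hn

/-- Arbitrarily far out there is a maximal run `x (p+1), …, x (q+1)` of minimal points in a plane
such that the neighbours `x p` and `x (q+2)` complete the plane to the whole space. -/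
lemma exists_run (hx : IsMinimalSeq ξ x) (hξ : Transcendental ℚ ξ) (N : ℕ) :
    ∃ p q, N ≤ p ∧ p + 1 ≤ q ∧
      (∀ k, p + 1 ≤ k → k ≤ q + 1 →
        ratPt (x k) ∈ Submodule.span ℚ {ratPt (x q), ratPt (x (q + 1))}) ∧
      ratPt (x p) ∉ Submodule.span ℚ {ratPt (x q), ratPt (x (q + 1))} ∧
      LinearIndependent ℚ
        ![ratPt (x (q + 2)), ratPt (x p), ratPt (x q), ratPt (x (q + 1))] := by
  classical
  have hdim : Module.finrank ℚ (Fin 4 → ℚ) = 4 := by simp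
  have hplane : ∀ n, Submodule.span ℚ {ratPt (x n), ratPt (x (n + 1))} ≠ ⊤ := fun n h => by
    have := hx.finrank_plane (Nat.lt_succ_self n)
    rw [h, finrank_top, hdim] at this
    omega
  obtain ⟨k, hNk, hk, hkm⟩ := hx.exists_first_notMem hξ (hplane N) N
  have hk2 : N + 2 ≤ k := by
    by_contra hcon
    have : k = N ∨ k = N + 1 := by omega
    rcases this with rfl | rfl <;> exact hk (Submodule.subset_span (by simp))
  obtain ⟨m, rfl⟩ : ∃ m, k = m + 2 := ⟨k - 2, by omega⟩
  have hm : ratPt (x (m + 2)) ∉ Submodule.span ℚ {ratPt (x m), ratPt (x (m + 1))} := by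
    rwa [hx.plane_eq (Nat.lt_succ_self m) (Nat.lt_succ_self N) (hkm m (by omega) (by omega))
      (hkm (m + 1) (by omega) (by omega))]
  set W := Submodule.span ℚ (Set.range ![ratPt (x m), ratPt (x (m + 1)), ratPt (x (m + 2))])
    with hWd
  have hW : W ≠ ⊤ := fun h => by
    have := finrank_range_le_card (R := ℚ) ![ratPt (x m), ratPt (x (m + 1)), ratPt (x (m + 2))]
    rw [Set.finrank, ← hWd, h, finrank_top, hdim] at this
    simp at this
  obtain ⟨k', hmk', hk', hkm'⟩ := hx.exists_first_notMem hξ hW m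
  have hk3 : m + 3 ≤ k' := by
    by_contra hcon
    have : k' = m ∨ k' = m + 1 ∨ k' = m + 2 := by omega
    rcases this with rfl | rfl | rfl
    · exact hk' (Submodule.subset_span ⟨0, rfl⟩)
    · exact hk' (Submodule.subset_span ⟨1, rfl⟩)
    · exact hk' (Submodule.subset_span ⟨2, rfl⟩)
  obtain ⟨q, rfl⟩ : ∃ q, k' = q + 2 := ⟨k' - 2, by omega⟩
  set V := Submodule.span ℚ {ratPt (x q), ratPt (x (q + 1))} with hV
  have hqV : ratPt (x q) ∈ V := Submodule.subset_span (by simp)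
  have hqV' : ratPt (x (q + 1)) ∈ V := Submodule.subset_span (by simp)
  have hex : ∃ n, ∀ k, n ≤ k → k ≤ q + 1 → ratPt (x k) ∈ V := ⟨q, fun k h1 h2 => by
    have : k = q ∨ k = q + 1 := by omega
    rcases this with rfl | rfl
    exacts [hqV, hqV']⟩
  have hpq : Nat.find hex ≤ q := Nat.find_min' hex fun k h1 h2 => by
    have : k = q ∨ k = q + 1 := by omega
    rcases this with rfl | rfl
    exacts [hqV, hqV']
  have hspec := Nat.find_spec hex
  have hpm : m < Nat.find hex := by
    by_contra hcon
    have h1 := hspec m (by omega) (by omega)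
    have h2 := hspec (m + 1) (by omega) (by omega)
    have h3 := hspec (m + 2) (by omega) (by omega)
    rw [hx.plane_eq (Nat.lt_succ_self m) (Nat.lt_succ_self q) h1 h2] at hm
    exact hm h3
  obtain ⟨p, hp⟩ : ∃ p, Nat.find hex = p + 1 := ⟨Nat.find hex - 1, by omega⟩
  have hpV : ratPt (x p) ∉ V := by
    intro hmem
    refine Nat.find_min hex (m := p) (by omega) fun k h1 h2 => ?_
    rcases Nat.eq_or_lt_of_le h1 with rfl | h3
    · exact hmem
    · exact hspec k (by omega) h2
  refine ⟨p, q, by omega, by omega, fun k h1 h2 => hspec k (by omega) h2, hpV, ?_⟩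
  refine linearIndependent_finCons.2 ⟨linearIndependent_finCons.2
    ⟨hx.linearIndependent_pair (Nat.lt_succ_self q), ?_⟩, fun hmem => hk' ?_⟩
  · rw [Matrix.range_cons_cons_empty]
    exact hpV
  · refine (Submodule.span_le.2 ?_ : Submodule.span ℚ _ ≤ W) hmem
    rintro _ ⟨i, rfl⟩
    fin_cases i
    exacts [hkm' p (by omega) (by omega), hkm' q (by omega) (by omega),
      hkm' (q + 1) (by omega) (by omega)]

end IsMinimalSeq

/-! ### The inequality between the exponents -/

/-- Integer linear forms in `ξ` and `1` are at least a constant times the power `-w` of the larger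
absolute value of their two coefficients. -/
def LinearFormsBounded (ξ w : ℝ) : Prop :=
  ∃ c : ℝ, 0 < c ∧ ∀ a b : ℤ, (a ≠ 0 ∨ b ≠ 0) →
    c * (max |(a : ℝ)| |(b : ℝ)|) ^ (-w) ≤ |(a : ℝ) * ξ - b|

lemma hankelCross_pair_bound {ξ : ℝ} {u : Fin 4 → ℤ} (hu : ‖err ξ u‖ ≤ |(u 0 : ℝ)|)
    (v : Fin 4 → ℤ) :
    |(lowerPair (hankelCross u) v : ℝ)| ≤ powBound ξ ^ 2 *
        (4 * (|(v 0 : ℝ)| * ‖err ξ u‖ ^ 2) + 42 * (|(u 0 : ℝ)| * ‖err ξ u‖ * ‖err ξ v‖)) ∧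
      |(upperPair (hankelCross u) v : ℝ)| ≤ powBound ξ ^ 2 *
        (4 * (|(v 0 : ℝ)| * ‖err ξ u‖ ^ 2) + 42 * (|(u 0 : ℝ)| * ‖err ξ u‖ * ‖err ξ v‖)) := by
  have hP := one_le_powBound ξ
  have hq := abs_quadVal_hankelCross_le ξ u
  have hh := abs_hankelCross_le hu
  have h1 := abs_lowerPair_le (ξ := ξ) hh v
  have h2 := abs_upperPair_le (ξ := ξ) hh v
  have hq' := mul_le_mul_of_nonneg_left hq (abs_nonneg (v 0 : ℝ))
  have hU : 0 ≤ |(u 0 : ℝ)| * ‖err ξ u‖ * ‖err ξ v‖ := by positivity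
  have hV : 0 ≤ |(v 0 : ℝ)| * ‖err ξ u‖ ^ 2 := by positivity
  set P := powBound ξ
  have hPP : P ≤ P ^ 2 := by nlinarith
  have e1 := mul_le_mul_of_nonneg_right hPP hU
  have e2 := mul_le_mul_of_nonneg_right hPP hV
  have e3 := mul_le_mul_of_nonneg_left hq' (zero_le_one.trans hP)
  have e4 := mul_nonneg (sq_nonneg P) hU
  constructor
  · linarith
  · linarith

/-- Three vectors orthogonal to a nonzero `r` are linearly dependent. -/
lemma mul_pair_hankelCross (r : Fin 3 → ℤ) {x y : Fin 4 → ℤ} (hx : lowerPair r x = 0)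
    (hx' : upperPair r x = 0) (hy : lowerPair r y = 0) (hy' : upperPair r y = 0) (k : Fin 3) :
    r k * lowerPair (hankelCross x) y = 0 ∧ r k * upperPair (hankelCross x) y = 0 := by
  simp only [lowerPair, upperPair, hankelCross, Matrix.cons_val] at *
  fin_cases k
  · constructor
    · simp only [Fin.zero_eta]
      linear_combination (x 2 * y 2 - x 3 * y 1) * hx + (y 1 * x 2 - y 2 * x 1) * hx'
        + (x 1 * x 3 - x 2 * x 2) * hy
    · simp only [Fin.zero_eta]
      linear_combination (x 2 * y 3 - x 3 * y 2) * hx + (y 2 * x 2 - y 3 * x 1) * hx'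
        + (x 1 * x 3 - x 2 * x 2) * hy'
  · constructor
    · simp only [Fin.mk_one]
      linear_combination (x 3 * y 0 - x 1 * y 2) * hx + (y 2 * x 0 - y 0 * x 2) * hx'
        + (x 1 * x 2 - x 0 * x 3) * hy
    · simp only [Fin.mk_one]
      linear_combination (x 3 * y 1 - x 1 * y 3) * hx + (y 3 * x 0 - y 1 * x 2) * hx'
        + (x 1 * x 2 - x 0 * x 3) * hy'
  · constructor
    · simp only [Fin.reduceFinMk]
      linear_combination (x 1 * y 1 - x 2 * y 0) * hx + (y 0 * x 1 - y 1 * x 0) * hx'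
        + (x 0 * x 2 - x 1 * x 1) * hy
    · simp only [Fin.reduceFinMk]
      linear_combination (x 1 * y 2 - x 2 * y 1) * hx + (y 1 * x 1 - y 2 * x 0) * hx'
        + (x 0 * x 2 - x 1 * x 1) * hy'

namespace IsMinimalSeq

variable {ξ : ℝ} {x : ℕ → Fin 4 → ℤ}

/-- The points of a run are integer combinations of its first two points. -/
lemma exists_int_comb_of_run (hx : IsMinimalSeq ξ x) {p q : ℕ} (hpq : p + 1 ≤ q)
    (hV : ∀ k, p + 1 ≤ k → k ≤ q + 1 →
      ratPt (x k) ∈ Submodule.span ℚ {ratPt (x q), ratPt (x (q + 1))}) (k : ℕ)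
    (h1 : p + 1 ≤ k) (h2 : k ≤ q + 1) : ∃ a b : ℤ, x k = a • x (p + 1) + b • x (p + 2) := by
  have hplane : Submodule.span ℚ {ratPt (x (p + 1)), ratPt (x (p + 2))}
      = Submodule.span ℚ {ratPt (x q), ratPt (x (q + 1))} :=
    hx.plane_eq (Nat.lt_succ_self _) (Nat.lt_succ_self _) (hV _ le_rfl (by omega))
      (hV _ (by omega) (by omega))
  have hmem := hV k h1 h2
  rw [← hplane] at hmem
  obtain ⟨t, a, b, ht, hab⟩ := exists_comb_of_ratPt_mem hmem
  obtain ⟨⟨a', rfl⟩, ⟨b', rfl⟩⟩ := hx.dvd_of_smul_eq_comb (p + 1) ht hab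
  refine ⟨a', b', ?_⟩
  ext j
  have := congrFun hab j
  simp only [Pi.add_apply, Pi.smul_apply, smul_eq_mul] at this ⊢
  exact mul_left_cancel₀ ht (by linear_combination this)

/-- If the Hankel cross product of the first point of a run does not annihilate the plane of the
run, neither does that of the last point. -/
lemma last_pair_ne_zero_of_run {p q : ℕ} (hpq : p + 1 ≤ q)
    (hV : ∀ k, p + 1 ≤ k → k ≤ q + 1 →
      ratPt (x k) ∈ Submodule.span ℚ {ratPt (x q), ratPt (x (q + 1))})
    (hN : hankelCross (x (q + 1)) ≠ 0)
    (hC1 : lowerPair (hankelCross (x (p + 1))) (x (p + 2)) ≠ 0 ∨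
      upperPair (hankelCross (x (p + 1))) (x (p + 2)) ≠ 0) :
    lowerPair (hankelCross (x (q + 1))) (x q) ≠ 0 ∨
      upperPair (hankelCross (x (q + 1))) (x q) ≠ 0 := by
  by_contra hcon
  push Not at hcon
  obtain ⟨k, hk⟩ := Function.ne_iff.mp hN
  set r := hankelCross (x (q + 1)) with hr
  have hz : ∀ k, p + 1 ≤ k → k ≤ q + 1 → lowerPair r (x k) = 0 ∧ upperPair r (x k) = 0 := by
    intro k h1 h2
    obtain ⟨t, a, b, ht, hab⟩ := exists_comb_of_ratPt_mem (hV k h1 h2)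
    have e1 := lowerPair_comb r a b (x q) (x (q + 1))
    have e2 := upperPair_comb r a b (x q) (x (q + 1))
    rw [← hab, hcon.1, hr, lowerPair_hankelCross_self, ← hr] at e1
    rw [← hab, hcon.2, hr, upperPair_hankelCross_self, ← hr] at e2
    have e3 := lowerPair_comb r t 0 (x k) 0
    have e4 := upperPair_comb r t 0 (x k) 0
    simp only [smul_zero, add_zero, zero_mul, mul_zero] at e1 e2 e3 e4
    rw [e1] at e3
    rw [e2] at e4
    exact ⟨(mul_eq_zero.1 e3.symm).resolve_left ht, (mul_eq_zero.1 e4.symm).resolve_left ht⟩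
  have z1 := hz (p + 1) le_rfl (by omega)
  have z2 := hz (p + 2) (by omega) (by omega)
  have := mul_pair_hankelCross r z1.1 z1.2 z2.1 z2.2 k
  rcases hC1 with h | h
  · exact h ((mul_eq_zero.1 this.1).resolve_left hk)
  · exact h ((mul_eq_zero.1 this.2).resolve_left hk)

/-- The determinant of the last two points of a run and the two neighbours of the run is a nonzero
integer. -/
lemma one_le_of_run (hx : IsMinimalSeq ξ x) {p q : ℕ} (hpq : p + 1 ≤ q)
    (hind : LinearIndependent ℚ
      ![ratPt (x (q + 2)), ratPt (x p), ratPt (x q), ratPt (x (q + 1))]) :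
    1 ≤ 24 * (x (q + 2) 0 * (‖err ξ (x p)‖ * (‖err ξ (x q)‖ * ‖err ξ (x (q + 1))‖))) := by
  have hX := hx.pos_real
  have hL := hx.err_pos
  have hXmono : ∀ {i j : ℕ}, i ≤ j → (x i 0 : ℝ) ≤ x j 0 := fun h => by
    exact_mod_cast hx.mono.monotone h
  have hLanti : ∀ {i j : ℕ}, i ≤ j → ‖err ξ (x j)‖ ≤ ‖err ξ (x i)‖ := fun h => hx.anti.antitone h
  have habs : ∀ i, |(x i 0 : ℝ)| = x i 0 := fun i => abs_of_pos (hX i)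
  have := one_le_of_linearIndependent (ξ := ξ) (Xm := x (q + 2) 0) (Lm := ‖err ξ (x (q + 2))‖)
    ![x (q + 2), x p, x q, x (q + 1)] (by
      convert hind using 1
      ext a
      fin_cases a <;> rfl) (hL _) (by
      intro a
      fin_cases a
      exacts [(habs _).le, (habs _).le.trans (hXmono (by omega)),
        (habs _).le.trans (hXmono (by omega)), (habs _).le.trans (hXmono (by omega))]) (by
      intro a
      fin_cases a
      exacts [le_rfl, hLanti (by omega), hLanti (by omega), hLanti (by omega)])
  rw [Fin.prod_univ_four] at this
  simp only [Matrix.cons_val] at this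
  refine this.trans_eq ?_
  have := (hL (q + 2)).ne'
  field_simp

lemma one_le_of_last_pair_ne_zero (hx : IsMinimalSeq ξ x) {q : ℕ}
    (hC2 : lowerPair (hankelCross (x (q + 1))) (x q) ≠ 0 ∨
      upperPair (hankelCross (x (q + 1))) (x q) ≠ 0) :
    1 ≤ 46 * powBound ξ ^ 2 * (x (q + 1) 0 * (‖err ξ (x (q + 1))‖ * ‖err ξ (x q)‖)) := by
  have hP := one_le_powBound ξ
  set P := powBound ξ with hPdef
  have hX := hx.pos_real
  have hXmono : ∀ {i j : ℕ}, i ≤ j → (x i 0 : ℝ) ≤ x j 0 := fun h => by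
    exact_mod_cast hx.mono.monotone h
  have hLanti : ∀ {i j : ℕ}, i ≤ j → ‖err ξ (x j)‖ ≤ ‖err ξ (x i)‖ := fun h => hx.anti.antitone h
  have habs : ∀ i, |(x i 0 : ℝ)| = x i 0 := fun i => abs_of_pos (hX i)
  have one_le_of : ∀ c : ℤ, c ≠ 0 → (1 : ℝ) ≤ |(c : ℝ)| := fun c hc => by
    exact_mod_cast Int.one_le_abs hc
  have hb := hankelCross_pair_bound (hx.err_le_coord (q + 1)) (x q)
  rw [habs, habs, ← hPdef] at hb
  have h1 : (x q 0 : ℝ) * ‖err ξ (x (q + 1))‖ ^ 2 ≤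
      x (q + 1) 0 * (‖err ξ (x (q + 1))‖ * ‖err ξ (x q)‖) := by
    rw [sq]
    have := hXmono (Nat.le_succ q)
    have := hLanti (Nat.le_succ q)
    have := (hX (q + 1)).le
    gcongr
  have h2 := mul_le_mul_of_nonneg_left h1 (sq_nonneg P)
  rcases hC2 with h | h
  · have := (one_le_of _ h).trans hb.1
    linarith
  · have := (one_le_of _ h).trans hb.2
    linarith

lemma first_pair_height_le (hx : IsMinimalSeq ξ x) (p : ℕ) :
    max |(lowerPair (hankelCross (x (p + 1))) (x (p + 2)) : ℝ)|
      |(upperPair (hankelCross (x (p + 1))) (x (p + 2)) : ℝ)| ≤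
      46 * powBound ξ ^ 2 * (x (p + 2) 0 * ‖err ξ (x (p + 1))‖ ^ 2) := by
  have hP := one_le_powBound ξ
  set P := powBound ξ with hPdef
  have hX := hx.pos_real
  have hXmono : ∀ {i j : ℕ}, i ≤ j → (x i 0 : ℝ) ≤ x j 0 := fun h => by
    exact_mod_cast hx.mono.monotone h
  have hLanti : ∀ {i j : ℕ}, i ≤ j → ‖err ξ (x j)‖ ≤ ‖err ξ (x i)‖ := fun h => hx.anti.antitone h
  have habs : ∀ i, |(x i 0 : ℝ)| = x i 0 := fun i => abs_of_pos (hX i)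
  have hb := hankelCross_pair_bound (hx.err_le_coord (p + 1)) (x (p + 2))
  rw [habs, habs, ← hPdef] at hb
  have h1 : (x (p + 1) 0 : ℝ) * ‖err ξ (x (p + 1))‖ * ‖err ξ (x (p + 2))‖ ≤
      x (p + 2) 0 * ‖err ξ (x (p + 1))‖ ^ 2 := by
    rw [sq, ← mul_assoc]
    have h1 : (x (p + 1) 0 : ℝ) ≤ x (p + 2) 0 := hXmono (by omega)
    have h2 : ‖err ξ (x (p + 2))‖ ≤ ‖err ξ (x (p + 1))‖ := hLanti (by omega)
    have := (hX (p + 2)).le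
    gcongr
  have h2 := mul_le_mul_of_nonneg_left h1 (sq_nonneg P)
  refine max_le (hb.1.trans ?_) (hb.2.trans ?_) <;> linarith

/-- The linear form at `(ξ, -1)` given by the first two points of a run is governed by the last two
points of the run: replacing `x (p+2)` by `x (q+1)` multiplies it by an integer of size about
`x (q+1) 0 / x (p+2) 0`. -/
lemma first_pair_value_le (hx : IsMinimalSeq ξ x) {p q : ℕ} (hpq : p + 1 ≤ q)
    (hV : ∀ k, p + 1 ≤ k → k ≤ q + 1 →
      ratPt (x k) ∈ Submodule.span ℚ {ratPt (x q), ratPt (x (q + 1))}) :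
    |(lowerPair (hankelCross (x (p + 1))) (x (p + 2)) : ℝ) * ξ
        - upperPair (hankelCross (x (p + 1))) (x (p + 2))| ≤
      9720 * powBound ξ ^ 4 * (x (p + 1) 0 * (‖err ξ (x q)‖ * ‖err ξ (x (q + 1))‖)) := by
  have hint := hx.exists_int_comb_of_run hpq hV
  set α := lowerPair (hankelCross (x (p + 1))) (x (p + 2))
  set β := upperPair (hankelCross (x (p + 1))) (x (p + 2))
  have hP := one_le_powBound ξ
  set P := powBound ξ with hPdef
  have hX := hx.pos_real
  have hL := hx.err_pos
  have habs : ∀ i, |(x i 0 : ℝ)| = x i 0 := fun i => abs_of_pos (hX i)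
  have one_le_of : ∀ c : ℤ, c ≠ 0 → (1 : ℝ) ≤ |(c : ℝ)| := fun c hc => by
    exact_mod_cast Int.one_le_abs hc
  obtain ⟨c', d, hcd⟩ := hint (q + 1) (by omega) le_rfl
  obtain ⟨a₁, b₁, hab₁⟩ := hint q (by omega) (by omega)
  have v1 : (d : ℝ) * (α * ξ - β) = ξ * lowerPair (hankelCross (x (p + 1))) (x (q + 1))
      - upperPair (hankelCross (x (p + 1))) (x (q + 1)) := by
    rw [hcd, lowerPair_comb, upperPair_comb, lowerPair_hankelCross_self,
      upperPair_hankelCross_self]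
    push_cast; ring
  have v2 : |(d : ℝ)| * |α * ξ - β| ≤
      30 * P ^ 2 * (x (p + 1) 0 * ‖err ξ (x (p + 1))‖ * ‖err ξ (x (q + 1))‖) := by
    rw [← abs_mul, v1]
    refine (abs_upperPair_sub_le (abs_hankelCross_le (hx.err_le_coord (p + 1)))
      (x (q + 1))).trans (le_of_eq ?_)
    rw [habs, ← hPdef]; ring
  have v3 : (x (q + 1) 0 : ℝ) ≤ 18 * P * (|(d : ℝ)| * x (p + 2) 0) := by
    obtain ⟨k, -, hk⟩ := hx.exists_wedge_ge (show p + 1 < q + 1 by omega)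
    have h1 := hx.abs_wedge_le (show p + 1 < p + 2 by omega) k
    have h2 := wedge_comb 1 0 c' d (x (p + 1)) (x (p + 2)) k
    rw [← hcd, one_smul, zero_smul, add_zero, one_mul, zero_mul, sub_zero] at h2
    rw [h2, Int.cast_mul, abs_mul] at hk
    have h3 := hk.trans (mul_le_mul_of_nonneg_left h1 (abs_nonneg (d : ℝ)))
    rw [← hPdef] at h3
    refine le_of_mul_le_mul_right ?_ (hL (p + 1))
    linarith
  have v4 : (x (p + 2) 0 : ℝ) * ‖err ξ (x (p + 1))‖ ≤ 18 * P * (x (q + 1) 0 * ‖err ξ (x q)‖) := by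
    obtain ⟨k, -, hk⟩ := hx.exists_wedge_ge (show p + 1 < p + 2 by omega)
    have h1 := hx.abs_wedge_le (show q < q + 1 by omega) k
    have hne := hx.wedge_ne_zero (show q < q + 1 by omega)
    have h2 := fun k => wedge_comb a₁ b₁ c' d (x (p + 1)) (x (p + 2)) k
    rw [← hcd, ← hab₁] at h2
    have hdet : a₁ * d - b₁ * c' ≠ 0 := by
      intro h0
      obtain ⟨k, hk⟩ := hne
      exact hk (by rw [h2, h0, zero_mul])
    rw [h2, Int.cast_mul, abs_mul, ← hPdef] at h1
    have h3 := le_mul_of_one_le_left (abs_nonneg (wedge (x (p + 1)) (x (p + 2)) k : ℝ))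
      (one_le_of _ hdet)
    linarith
  refine le_of_mul_le_mul_left ?_ (hX (q + 1))
  have hV0 := abs_nonneg ((α : ℝ) * ξ - β)
  calc x (q + 1) 0 * |(α : ℝ) * ξ - β|
      ≤ 18 * P * (|(d : ℝ)| * x (p + 2) 0) * |(α : ℝ) * ξ - β| := by gcongr
    _ = 18 * P * x (p + 2) 0 * (|(d : ℝ)| * |(α : ℝ) * ξ - β|) := by ring
    _ ≤ 18 * P * x (p + 2) 0 *
        (30 * P ^ 2 * (x (p + 1) 0 * ‖err ξ (x (p + 1))‖ * ‖err ξ (x (q + 1))‖)) := by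
      have := (hX (p + 2)).le
      gcongr
    _ = 540 * P ^ 3 * (x (p + 1) 0 * ‖err ξ (x (q + 1))‖) *
        (x (p + 2) 0 * ‖err ξ (x (p + 1))‖) := by ring
    _ ≤ 540 * P ^ 3 * (x (p + 1) 0 * ‖err ξ (x (q + 1))‖) *
        (18 * P * (x (q + 1) 0 * ‖err ξ (x q)‖)) := by
      have := (hX (p + 1)).le
      gcongr
    _ = _ := by ring

end IsMinimalSeq

/-- The linear arithmetic of the logarithms in `exponent_inequality`. -/
lemma log_inequality {l w K A a a' A' b₀ b' b₁ b₂ m c₁ c₂ c₃ c₄ : ℝ} (hl3 : 1 / 3 < l)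
    (hl2 : l ≤ 1 / 2) (hw : 0 ≤ w) (l1 : 0 ≤ c₃ + A' + (b₀ + (b₁ + b₂)))
    (l2 : 0 ≤ c₁ + A + (b₂ + b₁)) (l3 : m ≤ c₁ + a' + 2 * b')
    (l4 : c₄ + -w * m ≤ c₂ + a + (b₁ + b₂)) (k0 : b₀ ≤ K - l * a) (k1 : b' ≤ K - l * a')
    (k2 : b₁ ≤ K - l * A) (k3 : b₂ ≤ K - l * A') (a1 : a' ≤ A) :
    A * (l ^ 2 + 2 * l - 1 - l ^ 2 * (1 - 2 * l) * w) ≤ l ^ 2 * (c₂ - c₄)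
      + l ^ 2 * w * (c₁ + 2 * K) + l * (K + c₃) + 2 * K + (1 - l - l ^ 2) * c₁ := by
  have m1 : m ≤ c₁ + 2 * K + (1 - 2 * l) * A := by
    have := mul_le_mul_of_nonneg_left a1 (by linarith : 0 ≤ 1 - 2 * l)
    linarith
  have m2 : c₄ - w * (c₁ + 2 * K + (1 - 2 * l) * A) ≤ c₂ + (a + (b₁ + b₂)) := by
    have := mul_le_mul_of_nonneg_left m1 hw
    linarith
  have hl0 : 0 ≤ l := by linarith
  have m3 : l ^ 2 * a ≤ l * (K + c₃) + K - b₂ + l * b₁ + l * b₂ := by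
    have := mul_le_mul_of_nonneg_left (by linarith : l * a ≤ K + c₃ + A' + b₁ + b₂) hl0
    nlinarith
  have m4 : (1 - l - l ^ 2) * (-b₂) ≤ (1 - l - l ^ 2) * (c₁ + A + b₁) :=
    mul_le_mul_of_nonneg_left (by linarith) (by nlinarith)
  have m5 := mul_le_mul_of_nonneg_left m2 (sq_nonneg l)
  nlinarith

/-- The trade-off between an exponent `l` of uniform approximation to `ξ, ξ², ξ³` and an exponent
bounding rational approximation to `ξ`. -/
theorem exponent_inequality {ξ l w : ℝ} (hξ : Transcendental ℚ ξ) (h : UniformSimApprox 3 ξ l)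
    (hl : 1 < l ^ 2 + 2 * l) (hl3 : 1 / 3 < l) (hl2 : l ≤ 1 / 2) (hw : 0 ≤ w)
    (hb : LinearFormsBounded ξ w) : l ^ 2 + 2 * l - 1 ≤ l ^ 2 * (1 - 2 * l) * w := by
  have hirr : Irrational ξ := by
    rintro ⟨q, rfl⟩
    exact hξ (isAlgebraic_algebraMap q)
  obtain ⟨x, hx, K, hK⟩ := exists_isMinimalSeq hirr (by linarith) h
  obtain ⟨c, hc, hcb⟩ := hb
  have hP := one_le_powBound ξ
  set P := powBound ξ with hPdef
  by_contra hcon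
  push Not at hcon
  obtain ⟨N₁, hN₁⟩ := hx.hankelCross_ne_zero hK hl3
  obtain ⟨N₂, hN₂⟩ := hx.pair_ne_zero hK hl3 (by linarith) hl
  -- beyond this threshold `log_inequality` is violated
  obtain ⟨N₃, hN₃⟩ := hx.exists_log_gt ((l ^ 2 * (Real.log (9720 * P ^ 4) - Real.log c)
    + l ^ 2 * w * (Real.log (46 * P ^ 2) + 2 * K) + l * (K + Real.log 24) + 2 * K
    + (1 - l - l ^ 2) * Real.log (46 * P ^ 2)) / (l ^ 2 + 2 * l - 1 - l ^ 2 * (1 - 2 * l) * w))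
  obtain ⟨p, q, hNp, hpq, hV, hpV, hind⟩ := hx.exists_run hξ (max N₁ (max N₂ N₃))
  have hX := hx.pos_real
  have hL := hx.err_pos
  have hplane : Submodule.span ℚ {ratPt (x (p + 1)), ratPt (x (p + 2))}
      = Submodule.span ℚ {ratPt (x q), ratPt (x (q + 1))} :=
    hx.plane_eq (Nat.lt_succ_self _) (Nat.lt_succ_self _) (hV _ le_rfl (by omega))
      (hV _ (by omega) (by omega))
  have hC1 : lowerPair (hankelCross (x (p + 1))) (x (p + 2)) ≠ 0 ∨
      upperPair (hankelCross (x (p + 1))) (x (p + 2)) ≠ 0 := by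
    refine hN₂ p (by omega) ?_
    rintro ⟨t, a, b, ht, hab⟩
    exact hpV (hplane ▸ ratPt_mem_of_comb ht hab)
  have one_le_of : ∀ c : ℤ, c ≠ 0 → (1 : ℝ) ≤ |(c : ℝ)| := fun c hc => by
    exact_mod_cast Int.one_le_abs hc
  have hC2 := IsMinimalSeq.last_pair_ne_zero_of_run hpq hV (hN₁ (q + 1) (by omega)) hC1
  have hD := hx.one_le_of_run hpq hind
  have hE := hx.one_le_of_last_pair_ne_zero hC2
  have hheight := hx.first_pair_height_le p
  have hvalue := hx.first_pair_value_le hpq hV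
  rw [← hPdef] at hE hheight hvalue
  set α := lowerPair (hankelCross (x (p + 1))) (x (p + 2))
  set β := upperPair (hankelCross (x (p + 1))) (x (p + 2))
  have hmain := (hcb α β hC1).trans hvalue
  have hm1 : 0 < max |(α : ℝ)| |(β : ℝ)| := by
    rcases hC1 with h | h
    · exact lt_max_of_lt_left (zero_lt_one.trans_le (one_le_of _ h))
    · exact lt_max_of_lt_right (zero_lt_one.trans_le (one_le_of _ h))
  -- logarithmic form of the four estimates
  have hLp := hL p
  have hLp1 := hL (p + 1)
  have hLq := hL q
  have hLq1 := hL (q + 1)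
  have l1 := Real.log_nonneg hD
  rw [log_mul_mul (by norm_num) (hX _) (by positivity), Real.log_mul hLp.ne' (by positivity),
    Real.log_mul hLq.ne' hLq1.ne'] at l1
  have l2 := Real.log_nonneg hE
  rw [log_mul_mul (by positivity) (hX _) (by positivity), Real.log_mul hLq1.ne' hLq.ne'] at l2
  have l3 := Real.log_le_log hm1 hheight
  rw [log_mul_mul (by positivity) (hX _) (by positivity), Real.log_pow] at l3
  have l4 := Real.log_le_log (mul_pos hc (Real.rpow_pos_of_pos hm1 _)) hmain
  rw [Real.log_mul hc.ne' (Real.rpow_pos_of_pos hm1 _).ne', Real.log_rpow hm1,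
    log_mul_mul (by positivity) (hX _) (by positivity), Real.log_mul hLq.ne' hLq1.ne'] at l4
  push_cast at l3
  have k0 := hK p
  have k1 := hK (p + 1)
  have k2 := hK q
  have k3 := hK (q + 1)
  have a1 := hx.log_le_log (show p + 2 ≤ q + 1 by omega)
  have hbig := hN₃ (q + 1) (by omega)
  rw [div_lt_iff₀ (by linarith)] at hbig
  change Real.log ‖err ξ (x (p + 1))‖ ≤ K - l * Real.log (x (p + 2) 0) at k1
  change Real.log ‖err ξ (x (q + 1))‖ ≤ K - l * Real.log (x (q + 2) 0) at k3
  exact absurd (log_inequality hl3 hl2 hw l1 l2 l3 l4 k0 k1 k2 k3 a1) (not_le.2 hbig)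

/-! ### Rational approximation to `ξ` and pigeonhole bounds -/

/-- Nonzero integer linear forms with bounded coefficients stay away from `0`. -/
lemma exists_pos_le_of_bounded {ξ : ℝ} (hξ : Irrational ξ) (N : ℕ) :
    ∃ δ : ℝ, 0 < δ ∧ ∀ a b : ℤ, (a ≠ 0 ∨ b ≠ 0) → |a| ≤ N → |b| ≤ N → δ ≤ |(a : ℝ) * ξ - b| := by
  classical
  have hpos : ∀ a b : ℤ, (a ≠ 0 ∨ b ≠ 0) → 0 < |(a : ℝ) * ξ - b| := by
    intro a b hab
    rw [abs_pos]
    by_cases ha : a = 0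
    · have hb : (b : ℝ) ≠ 0 := by exact_mod_cast hab.resolve_left (not_not.2 ha)
      simpa [ha] using hb
    · exact sub_ne_zero.2 ((hξ.intCast_mul ha).ne_int b)
  set s : Finset (ℤ × ℤ) := (Finset.Icc (-(N : ℤ)) N ×ˢ Finset.Icc (-(N : ℤ)) N).filter
    fun p => p.1 ≠ 0 ∨ p.2 ≠ 0 with hs
  have hmem : ∀ a b : ℤ, (a ≠ 0 ∨ b ≠ 0) → |a| ≤ N → |b| ≤ N → (a, b) ∈ s := by
    intro a b hab ha hb
    rw [abs_le] at ha hb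
    simp [hs, ha, hb, hab]
  rcases s.eq_empty_or_nonempty with h | h
  · exact ⟨1, one_pos, fun a b hab ha hb => by simpa [h] using hmem a b hab ha hb⟩
  · obtain ⟨p, hp, hmin⟩ := s.exists_min_image (fun p => |(p.1 : ℝ) * ξ - p.2|) h
    exact ⟨_, hpos _ _ (Finset.mem_filter.1 hp).2,
      fun a b hab ha hb => hmin (a, b) (hmem a b hab ha hb)⟩

lemma linearFormsBounded_of_not_dualApprox {ξ w : ℝ} (hξ : Irrational ξ) (hw : 0 ≤ w)
    (h : ¬DualApprox 1 ξ w) : LinearFormsBounded ξ w := by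
  rw [DualApprox, not_frequently] at h
  obtain ⟨Q₀, hQ₀⟩ := eventually_atTop.1 h
  obtain ⟨δ, hδ, hδle⟩ := exists_pos_le_of_bounded hξ ⌈Q₀⌉₊
  refine ⟨min δ 1, lt_min hδ one_pos, fun a b hab => ?_⟩
  have hH1 : 1 ≤ max |(a : ℝ)| |(b : ℝ)| := by
    rcases hab with h | h
    · exact le_max_of_le_left (by exact_mod_cast Int.one_le_abs h)
    · exact le_max_of_le_right (by exact_mod_cast Int.one_le_abs h)
  set H := max |(a : ℝ)| |(b : ℝ)| with hH
  have hpow : 0 ≤ H ^ (-w) := Real.rpow_nonneg (zero_le_one.trans hH1) _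
  rcases le_total Q₀ H with hc | hc
  · refine (mul_le_of_le_one_left hpow (min_le_right _ _)).trans ?_
    by_contra hlt
    push Not at hlt
    have heval : aeval ξ (C a * X - C b : ℤ[X]) = (a : ℝ) * ξ - b := by simp
    refine hQ₀ H hc ⟨C a * X - C b, ?_, fun k => ?_, ?_, ?_⟩
    · compute_degree
    · simp only [coeff_sub, coeff_C_mul, coeff_X, coeff_C]
      rcases k with _ | _ | k
      · simp [hH]
      · simp [hH]
      · simpa using zero_le_one.trans hH1
    · obtain ⟨δ', hδ', hle⟩ := exists_pos_le_of_bounded hξ (max a.natAbs b.natAbs)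
      rw [heval]
      refine hδ'.trans_le (hle a b hab ?_ ?_) <;> push_cast
      · simp
      · simp
    · rw [heval]; exact hlt.le
  · have hN : H ≤ (⌈Q₀⌉₊ : ℝ) := hc.trans (Nat.le_ceil Q₀)
    have h1 : |a| ≤ (⌈Q₀⌉₊ : ℤ) := by
      have := (le_max_left _ _).trans hN
      exact_mod_cast this
    have h2 : |b| ≤ (⌈Q₀⌉₊ : ℤ) := by
      have := (le_max_right _ _).trans hN
      exact_mod_cast this
    calc min δ 1 * H ^ (-w) ≤ min δ 1 * 1 := by
          refine mul_le_mul_of_nonneg_left ?_ (lt_min hδ one_pos).le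
          exact Real.rpow_le_one_of_one_le_of_nonpos hH1 (by linarith)
      _ ≤ δ := by rw [mul_one]; exact min_le_left _ _
      _ ≤ _ := hδle a b hab h1 h2

/-- If `ξ` is too close to `b / a` in lowest terms, then no integer point with `|x₀| < |a|³`
approximates `(ξ, ξ², ξ³)` well: the linear form `a T - b` and its shifts would vanish at it. -/
lemma not_dualApprox_of_uniformSimApprox {ξ l : ℝ} (hξ : Irrational ξ) (hl : 1 / 3 < l)
    (h : UniformSimApprox 3 ξ l) : ¬DualApprox 1 ξ 4 := by
  intro hd
  rw [uniformSimApprox_iff] at h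
  have hP := one_le_powBound ξ
  set P := powBound ξ with hPdef
  -- conditions on `|a|` that hold once it is large
  have hev : ∀ᶠ A : ℝ in atTop, (∃ x : Fin 4 → ℤ, x 0 ≠ 0 ∧ |(x 0 : ℝ)| ≤ A ^ 3 / 2 ∧
      ‖err ξ x‖ < (A ^ 3 / 2) ^ (-l)) ∧ 3 * P * (A * (A ^ 3 / 2) ^ (-l)) < 1 / 2 ∧ P ≤ A := by
    have ht : Tendsto (fun A : ℝ => A ^ 3 / 2) atTop atTop :=
      (tendsto_pow_atTop (by norm_num)).atTop_div_const (by norm_num)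
    refine (ht.eventually h).and (Eventually.and ?_ (eventually_ge_atTop P))
    have h1 : Tendsto (fun A : ℝ => 3 * P * 2 ^ l * A ^ (-(3 * l - 1))) atTop (nhds 0) := by
      simpa using (tendsto_rpow_neg_atTop (by linarith : 0 < 3 * l - 1)).const_mul (3 * P * 2 ^ l)
    filter_upwards [h1.eventually_lt_const (by norm_num : (0 : ℝ) < 1 / 2),
      eventually_gt_atTop 0] with A hA hA0
    refine lt_of_eq_of_lt ?_ hA
    have e1 : (A ^ 3 / 2) ^ (-l) = 2 ^ l * A ^ (-(3 * l)) := by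
      rw [Real.div_rpow (by positivity) (by norm_num), ← Real.rpow_natCast A 3,
        ← Real.rpow_mul hA0.le, Real.rpow_neg (by norm_num : (0 : ℝ) ≤ 2), div_inv_eq_mul, mul_comm]
      congr 2
      push_cast; ring
    have e2 : A ^ (-(3 * l - 1)) = A * A ^ (-(3 * l)) := by
      rw [show -(3 * l - 1) = 1 + -(3 * l) by ring, Real.rpow_add hA0, Real.rpow_one]
    rw [e1, e2]; ring
  obtain ⟨M, hM⟩ := eventually_atTop.1 hev
  obtain ⟨δ, hδ, hδle⟩ := exists_pos_le_of_bounded hξ ⌈2 * P * max M 1⌉₊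
  have hsmall : ∀ᶠ Q : ℝ in atTop, 1 ≤ Q ∧ Q ^ (-(4 : ℝ)) < δ :=
    (eventually_ge_atTop 1).and
      ((tendsto_rpow_neg_atTop (by norm_num : (0 : ℝ) < 4)).eventually_lt_const hδ)
  obtain ⟨Q, ⟨p, hdeg, hcoeff, hp0, hpQ⟩, hQ1, hQδ⟩ := (hd.and_eventually hsmall).exists
  have hpe : aeval ξ p = (p.coeff 1 : ℝ) * ξ + p.coeff 0 := by
    conv_lhs => rw [eq_X_add_C_of_natDegree_le_one hdeg]
    simp
  have hne : p.coeff 1 ≠ 0 ∨ p.coeff 0 ≠ 0 := by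
    by_contra hcon
    push Not at hcon
    rw [hpe, hcon.1, hcon.2] at hp0
    simp at hp0
  have hgpos : 0 < Int.gcd (p.coeff 1) (-p.coeff 0) := by
    refine Nat.pos_of_ne_zero fun h0 => ?_
    rw [Int.gcd_eq_zero_iff, neg_eq_zero] at h0
    rcases hne with h | h
    exacts [h h0.1, h h0.2]
  obtain ⟨g, a, b, hg, hab, ha, hb⟩ := Int.exists_gcd_one' hgpos
  have hg1 : (1 : ℝ) ≤ g := by exact_mod_cast hg
  have haR : (p.coeff 1 : ℝ) = a * g := by exact_mod_cast ha
  have hbR : (p.coeff 0 : ℝ) = -(b * g) := by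
    have : -(p.coeff 0 : ℝ) = b * g := by exact_mod_cast hb
    linarith
  have hD : |(a : ℝ) * ξ - b| ≤ Q ^ (-(4 : ℝ)) := by
    refine le_trans ?_ hpQ
    rw [hpe, haR, hbR, show (a : ℝ) * g * ξ + -(b * g) = g * (a * ξ - b) by ring, abs_mul,
      abs_of_pos (by linarith : (0 : ℝ) < g)]
    exact le_mul_of_one_le_left (abs_nonneg _) hg1
  have hQ4 : Q ^ (-(4 : ℝ)) ≤ 1 := Real.rpow_le_one_of_one_le_of_nonpos hQ1 (by norm_num)
  set A : ℝ := |(a : ℝ)| with hA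
  have hAQ : A ≤ Q := by
    have h1 := hcoeff 1
    have h2 : |(p.coeff 1 : ℝ)| ≤ Q := by exact_mod_cast h1
    rw [haR, abs_mul, abs_of_pos (by linarith : (0 : ℝ) < g)] at h2
    exact (le_mul_of_one_le_right (abs_nonneg _) hg1).trans h2
  have hbA : |(b : ℝ)| ≤ A * P + 1 := by
    rw [show (b : ℝ) = a * ξ - (a * ξ - b) by ring]
    exact abs_sub_le' (abs_mul_le le_rfl (abs_self_le_powBound ξ)) (hD.trans hQ4)
  have hAM : max M 1 < A := by
    by_contra hcon
    push Not at hcon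
    have hm := le_max_right M 1
    have h1 : A ≤ 2 * P * max M 1 := by nlinarith
    have h2 : |(b : ℝ)| ≤ 2 * P * max M 1 := by nlinarith
    have h3 := Nat.le_ceil (2 * P * max M 1)
    have h4 := hδle a b (by
      by_contra hc
      push Not at hc
      rw [hc.1, hc.2] at hab
      simp at hab) (by rw [hA] at h1; exact_mod_cast h1.trans h3)
      (by exact_mod_cast h2.trans h3)
    linarith
  have hA1 : 1 < A := (le_max_right _ _).trans_lt hAM
  obtain ⟨⟨x, hx0, hxA, hxerr⟩, hsm, hPA⟩ := hM A ((le_max_left _ _).trans hAM.le)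
  have hDA : |(x 0 : ℝ) * (a * ξ - b)| ≤ 1 / (2 * A) := by
    have h4 : Q ^ (-(4 : ℝ)) ≤ 1 / A ^ 4 := by
      rw [Real.rpow_neg (by linarith), one_div, show (4 : ℝ) = ((4 : ℕ) : ℝ) by norm_num,
        Real.rpow_natCast]
      gcongr
    refine (abs_mul_le hxA (hD.trans h4)).trans (le_of_eq ?_)
    field_simp
  have hzero : ∀ k m : Fin 4, (m : ℕ) = k + 1 → a * x m = b * x k := by
    intro k m hm
    by_contra hne
    have e := shifted_form_eq ξ a b x hm
    have h1 : (1 : ℝ) ≤ |((a * x m - b * x k : ℤ) : ℝ)| := by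
      exact_mod_cast Int.one_le_abs (sub_ne_zero.2 hne)
    rw [e] at h1
    have h2 := h1.trans (abs_add_le' (abs_mul_le (abs_pow_le_powBound ξ k) hDA)
      (abs_sub_le' (abs_mul_le hbA ((abs_err_le ξ x k).trans hxerr.le))
        (abs_mul_le le_rfl ((abs_err_le ξ x m).trans hxerr.le))))
    rw [← hPdef] at h2
    have h3 : P * (1 / (2 * A)) ≤ 1 / 2 := by
      rw [mul_one_div, div_le_div_iff₀ (by linarith) (by norm_num)]; linarith
    have hpw : 0 ≤ (A ^ 3 / 2) ^ (-l) := by positivity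
    change 1 ≤ P * (1 / (2 * A)) + ((A * P + 1) * (A ^ 3 / 2) ^ (-l) + A * (A ^ 3 / 2) ^ (-l)) at h2
    have h4 : (A * P + 1) * (A ^ 3 / 2) ^ (-l) + A * (A ^ 3 / 2) ^ (-l) ≤
        3 * P * (A * (A ^ 3 / 2) ^ (-l)) := by
      rw [← add_mul, ← mul_assoc]
      refine mul_le_mul_of_nonneg_right ?_ hpw
      nlinarith
    linarith
  have h1 := hzero 0 1 rfl
  have h2 := hzero 1 2 rfl
  have h3 := hzero 2 3 rfl
  have h4 := abs_cube_le_of_geometric hab hx0 h1 h2 h3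
  have h5 : A ^ 3 ≤ |(x 0 : ℝ)| := by rw [hA]; exact_mod_cast h4
  have : 0 < A ^ 3 := by positivity
  linarith

/-- A weak form of Dirichlet's theorem, by the pigeonhole principle. -/
lemma uniformSimApprox_sixth (ξ : ℝ) : UniformSimApprox 3 ξ (1 / 6) := by
  classical
  unfold UniformSimApprox
  filter_upwards [eventually_gt_atTop 64] with Q hQ
  set N := ⌊Q ^ (1 / 3 : ℝ)⌋₊ with hN
  have hQ0 : 0 ≤ Q := by linarith
  have hroot : (2 : ℝ) < Q ^ (1 / 6 : ℝ) := by
    have : (64 : ℝ) ^ (1 / 6 : ℝ) = 2 := by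
      rw [show (64 : ℝ) = 2 ^ (6 : ℝ) by norm_num, ← Real.rpow_mul (by norm_num)]; norm_num
    rw [← this]
    exact Real.rpow_lt_rpow (by norm_num) hQ (by norm_num)
  have hsq : Q ^ (1 / 3 : ℝ) = Q ^ (1 / 6 : ℝ) * Q ^ (1 / 6 : ℝ) := by
    rw [← Real.rpow_add (by linarith)]; norm_num
  have hNlt : Q ^ (1 / 3 : ℝ) < N + 1 := Nat.lt_floor_add_one _
  have hN1 : 1 ≤ (N : ℝ) := by
    have : (1 : ℝ) < N + 1 := by nlinarith
    have : 0 < N := by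
      have h : (0 : ℝ) < N := by linarith
      exact_mod_cast h
    exact_mod_cast this
  have hN3 : (N : ℝ) ^ 3 ≤ Q := by
    have h1 : (N : ℝ) ≤ Q ^ (1 / 3 : ℝ) := Nat.floor_le (by positivity)
    calc (N : ℝ) ^ 3 ≤ (Q ^ (1 / 3 : ℝ)) ^ 3 := by gcongr
      _ = Q := by rw [← Real.rpow_natCast, ← Real.rpow_mul hQ0]; norm_num
  have hNinv : 1 / (N : ℝ) < Q ^ (-(1 / 6) : ℝ) := by
    rw [Real.rpow_neg hQ0, one_div]
    refine inv_strictAnti₀ (by linarith) ?_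
    nlinarith
  have hcard : (Fintype.piFinset fun _ : Fin 3 => Finset.range N).card
      < (Finset.range (N ^ 3 + 1)).card := by
    simp
  obtain ⟨m, hm, n, hn, hmn, hf⟩ := Finset.exists_ne_map_eq_of_card_lt_of_maps_to hcard
    (f := fun m => fun j : Fin 3 => ⌊(N : ℝ) * Int.fract ((m : ℝ) * ξ ^ ((j : ℕ) + 1))⌋₊) (by
      intro m _
      simp only [Finset.mem_coe, Fintype.mem_piFinset, Finset.mem_range]
      intro j
      rw [Nat.floor_lt (mul_nonneg (Nat.cast_nonneg N) (Int.fract_nonneg _))]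
      have := Int.fract_lt_one ((m : ℝ) * ξ ^ ((j : ℕ) + 1))
      nlinarith)
  wlog hlt : m < n generalizing m n
  · exact this n hn m hm hmn.symm hf.symm (lt_of_le_of_ne (not_lt.1 hlt) hmn.symm)
  have hn' : n ≤ N ^ 3 := Nat.lt_succ_iff.1 (Finset.mem_range.1 hn)
  refine ⟨Fin.cons ((n : ℤ) - m) fun j => ⌊(n : ℝ) * ξ ^ ((j : ℕ) + 1)⌋
    - ⌊(m : ℝ) * ξ ^ ((j : ℕ) + 1)⌋, ?_, ?_, ?_⟩
  · rw [Fin.cons_zero]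
    exact Int.one_le_abs (by omega)
  · rw [Fin.cons_zero]
    have h1 : (m : ℝ) < n := by exact_mod_cast hlt
    push_cast
    rw [abs_of_pos (by linarith)]
    have : (n : ℝ) ≤ (N : ℝ) ^ 3 := by exact_mod_cast hn'
    have h0 : (0 : ℝ) ≤ m := Nat.cast_nonneg m
    linarith
  · intro j
    rw [Fin.cons_zero, Fin.cons_succ]
    refine lt_trans ?_ hNinv
    have hj := congrFun hf j
    beta_reduce at hj
    set u := Int.fract ((m : ℝ) * ξ ^ ((j : ℕ) + 1)) with hu
    set v := Int.fract ((n : ℝ) * ξ ^ ((j : ℕ) + 1)) with hv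
    have e : (((n : ℤ) - m : ℤ) : ℝ) * ξ ^ ((j : ℕ) + 1) -
        ((⌊(n : ℝ) * ξ ^ ((j : ℕ) + 1)⌋ - ⌊(m : ℝ) * ξ ^ ((j : ℕ) + 1)⌋ : ℤ) : ℝ) = v - u := by
      rw [hu, hv, Int.fract, Int.fract]; push_cast; ring
    rw [e, lt_div_iff₀ (by linarith), ← abs_of_nonneg (Nat.cast_nonneg N : (0 : ℝ) ≤ N), ← abs_mul,
      abs_lt]
    have u1 := Nat.floor_le (mul_nonneg (Nat.cast_nonneg N) (Int.fract_nonneg _) : 0 ≤ (N : ℝ) * u)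
    have u2 := Nat.lt_floor_add_one ((N : ℝ) * u)
    have v1 := Nat.floor_le (mul_nonneg (Nat.cast_nonneg N) (Int.fract_nonneg _) : 0 ≤ (N : ℝ) * v)
    have v2 := Nat.lt_floor_add_one ((N : ℝ) * v)
    rw [hj] at u1 u2
    constructor <;> nlinarith

/-! ### The exponents -/

lemma DualApprox.mono {n : ℕ} {ξ w w' : ℝ} (h : DualApprox n ξ w) (hw : w' ≤ w) :
    DualApprox n ξ w' := by
  refine (h.and_eventually (eventually_ge_atTop 1)).mono ?_
  rintro Q ⟨⟨p, h1, h2, h3, h4⟩, hQ⟩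
  exact ⟨p, h1, h2, h3, h4.trans (Real.rpow_le_rpow_of_exponent_le hQ (neg_le_neg hw))⟩

lemma dualApprox_zero (n : ℕ) (ξ : ℝ) : DualApprox n ξ 0 := by
  refine Eventually.frequently ?_
  filter_upwards [eventually_ge_atTop 1] with Q hQ
  refine ⟨1, by simp, fun k => ?_, by simp, by simp⟩
  rw [coeff_one]
  split_ifs
  · simpa using hQ
  · simpa using zero_le_one.trans hQ

lemma not_dualApprox_of_omegaExp_lt {n : ℕ} {ξ w : ℝ} (h : omegaExp n ξ < w) :
    ¬DualApprox n ξ w := fun hd =>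
  absurd (show (w : EReal) ≤ omegaExp n ξ from le_sSup ⟨w, hd, rfl⟩) (not_le.2 h)

/-- `x ↦ 2x³ + 2x` takes the value `1` close to `0.42385`. -/
lemma exists_root : ∃ r : ℝ, 2 * r ^ 3 + 2 * r = 1 ∧ 0.42385 ≤ r ∧ r < 0.42386 := by
  have hcont : ContinuousOn (fun r : ℝ => 2 * r ^ 3 + 2 * r) (Set.Icc 0.42385 0.42386) := by
    fun_prop
  obtain ⟨r, ⟨h1, h2⟩, hr⟩ := intermediate_value_Icc (by norm_num) hcont
    (show (1 : ℝ) ∈ _ by constructor <;> norm_num)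
  refine ⟨r, hr, h1, lt_of_le_of_ne h2 ?_⟩
  rintro rfl
  norm_num at hr

theorem theorem3 (ξ : ℝ) (hξ : Transcendental ℚ ξ) :
    ∃ l : ℝ, lambdaHat 3 ξ = (l : EReal) ∧
      ((∃ w : ℝ, omegaExp 1 ξ = (w : EReal) ∧
          2 * l ^ 3 * w - l ^ 2 * (w - 1) + 2 * l ≤ 1) ∨
        (omegaExp 1 ξ = ⊤ ∧ 2 * l ^ 3 - l ^ 2 < 0)) ∧
      ∃ r : ℝ, 2 * r ^ 3 + 2 * r = 1 ∧ 0.42385 ≤ r ∧ r < 0.42386 ∧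
        (omegaExp 1 ξ = 1 → l ≤ r) := by
  have hirr : Irrational ξ := by
    rintro ⟨q, rfl⟩
    exact hξ (isAlgebraic_algebraMap q)
  set S : Set ℝ := {l | UniformSimApprox 3 ξ l} with hS
  have hS6 : (1 / 6 : ℝ) ∈ S := uniformSimApprox_sixth ξ
  have hlt : ∀ l ∈ S, l ≤ 1 / 2 := by
    intro l hl
    by_contra hcon
    push Not at hcon
    have h2 : UniformSimApprox 3 ξ (1 / 2) := UniformSimApprox.mono hl hcon.le
    have h4 := linearFormsBounded_of_not_dualApprox hirr (by norm_num)
      (not_dualApprox_of_uniformSimApprox hirr (by norm_num) h2)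
    have := exponent_inequality hξ h2 (by norm_num) (by norm_num) le_rfl (by norm_num) h4
    norm_num at this
  have hbdd : BddAbove S := ⟨1 / 2, hlt⟩
  set L := sSup S with hL
  have hlub : IsLUB S L := isLUB_csSup ⟨_, hS6⟩ hbdd
  have hL6 : 1 / 6 ≤ L := hlub.1 hS6
  have hL2 : L ≤ 1 / 2 := hlub.2 hlt
  have hlam : lambdaHat 3 ξ = (L : EReal) := by
    refine le_antisymm (sSup_le ?_) (le_of_forall_lt fun c hc => ?_)
    · rintro _ ⟨l, hl, rfl⟩
      exact EReal.coe_le_coe_iff.2 (hlub.1 hl)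
    · obtain ⟨z, hcz, hzL⟩ := EReal.lt_iff_exists_real_btwn.1 hc
      obtain ⟨l, hl, hzl⟩ := exists_lt_of_lt_csSup ⟨_, hS6⟩ (EReal.coe_lt_coe_iff.1 hzL)
      exact (hcz.trans (EReal.coe_lt_coe_iff.2 hzl)).trans_le (le_sSup ⟨l, hl, rfl⟩)
  have hω0 : (0 : EReal) ≤ omegaExp 1 ξ := le_sSup ⟨0, dualApprox_zero 1 ξ, rfl⟩
  have hfinite : ∀ w : ℝ, omegaExp 1 ξ = (w : EReal) →
      2 * L ^ 3 * w - L ^ 2 * (w - 1) + 2 * L ≤ 1 := by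
    intro w hw
    have hw0 : 0 ≤ w := by rw [hw] at hω0; exact_mod_cast hω0
    rcases le_or_gt (L ^ 2 + 2 * L) 1 with hc | hc
    · have : 0 ≤ L ^ 2 * (1 - 2 * L) * w :=
        mul_nonneg (mul_nonneg (sq_nonneg L) (by linarith)) hw0
      nlinarith
    · obtain ⟨u, -, hu, huS⟩ := exists_seq_tendsto_sSup ⟨_, hS6⟩ hbdd
      have hL3 : 1 / 3 < L := by nlinarith
      have hw' : Tendsto (fun n : ℕ => w + 1 / ((n : ℝ) + 1)) atTop (nhds (w + 0)) :=
        tendsto_const_nhds.add tendsto_one_div_add_atTop_nhds_zero_nat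
      rw [add_zero] at hw'
      have hleft : Tendsto (fun n => u n ^ 2 + 2 * u n) atTop (nhds (L ^ 2 + 2 * L)) :=
        (hu.pow 2).add (hu.const_mul 2)
      have hright : Tendsto (fun n : ℕ => u n ^ 2 * (1 - 2 * u n) * (w + 1 / ((n : ℝ) + 1))) atTop
          (nhds (L ^ 2 * (1 - 2 * L) * w)) :=
        ((hu.pow 2).mul ((hu.const_mul 2).const_sub 1)).mul hw'
      have := le_of_tendsto_of_tendsto (hleft.sub_const 1) hright (by
        filter_upwards [hleft.eventually_const_lt hc, hu.eventually_const_lt hL3] with n h1 h2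
        have hpos : 0 < 1 / ((n : ℝ) + 1) := Nat.one_div_pos_of_nat
        refine exponent_inequality hξ (huS n) h1 h2 (hlt _ (huS n)) (by linarith)
          (linearFormsBounded_of_not_dualApprox hirr (by linarith)
            (not_dualApprox_of_omegaExp_lt ?_))
        rw [hw]
        exact EReal.coe_lt_coe_iff.2 (by linarith))
      linarith
  refine ⟨L, hlam, ?_, ?_⟩
  · rcases eq_or_ne (omegaExp 1 ξ) ⊤ with htop | htop
    · refine Or.inr ⟨htop, ?_⟩
      have hL3 : L ≤ 1 / 3 := by
        refine hlub.2 fun l hl => ?_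
        by_contra hcon
        push Not at hcon
        have h4 := not_dualApprox_of_uniformSimApprox hirr hcon hl
        have hlt4 : ((4 : ℝ) : EReal) < omegaExp 1 ξ := by rw [htop]; exact EReal.coe_lt_top _
        obtain ⟨_, ⟨w, hw, rfl⟩, h4w⟩ := lt_sSup_iff.1 hlt4
        exact h4 (DualApprox.mono hw (EReal.coe_lt_coe_iff.1 h4w).le)
      nlinarith [mul_pos (by linarith : 0 < L) (by linarith : 0 < L)]
    · have hbot : omegaExp 1 ξ ≠ ⊥ := fun h => by simp [h] at hω0
      have hcoe := (EReal.coe_toReal htop hbot).symm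
      exact Or.inl ⟨_, hcoe, hfinite _ hcoe⟩
  · obtain ⟨r, hr, h1, h2⟩ := exists_root
    refine ⟨r, hr, h1, h2, fun hω => ?_⟩
    have h3 := hfinite 1 (by rw [hω]; rfl)
    by_contra hcon
    push Not at hcon
    have : r ^ 3 < L ^ 3 := pow_lt_pow_left₀ hcon (by linarith) (by norm_num)
    linarith
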